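/- There exist absolute constants $C, C' > 0$ such that the following holds. Let $d \ge 1$, let $\mathcal C$ be a symmetric positive definite $d \times d$ matrix, let $\gamma^{\mathcal C} = \mathcal N(0,\mathcal C)$ be the centered Gaussian measure on $\mathbb R^d$ with covariance matrix $\mathcal C$, let $\nu$ be any probability measure on $\mathbb R^d$, and let $\varepsilon > 0$. Let $\pi$ be the Hit-and-Run transition kernel for $\gamma^{\mathcal C}$: from $x$, draw $v$ uniformly from the unit sphere $\mathbb S^{d-1}$, then draw $H \in \mathbb R$ with density in $h$ proportional to the density of $\gamma^{\mathcal C}$ at $x + hv$, and move to $x + Hv$. Then the mixing time of Hit-and-Run started from $\nu$ satisfies $$\tau_{\mathrm{mix}}(\varepsilon,\nu) = \inf\{ n \in \mathbb N : \mathrm{TV}(\nu\pi^n, \gamma^{\mathcal C}) \le \varepsilon \} \le C \rho^{-1} \log\Bigl( \max\Bigl( e,\; C' \max(\kappa, M, m^{-1})\, d\, \varepsilon^{-1}\, \mathcal W^2_{\mathcal C^{-1/2}}(\gamma^{\mathcal C}, \nu) \Bigr)\Bigr).$$ Here $\mathrm{TV}(\mu,\eta) = \sup_A |\mu(A) - \eta(A)|$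 is the total variation distance; $M$, $m$ and $\kappa = M/m$ are the largest eigenvalue, the smallest eigenvalue and the condition number of $\mathcal C^{-1}$; $$\rho = \frac12 \inf_{|\zeta|=1} \mathbb E_{v \sim \mathrm{Unif}(\mathbb S^{d-1})} \Bigl( \zeta \cdot \frac{\mathcal C^{-1/2} v}{|\mathcal C^{-1/2} v|} \Bigr)^2 ;$$ and $\mathcal W^2_{\mathcal C^{-1/2}}(\mu,\eta) = \inf \bigl( \mathbb E |\mathcal C^{-1/2}(X - Y)|^2 \bigr)^{1/2}$, the infimum over all couplings $(X,Y)$ of $\mu$ and $\eta$, is the $L^2$-Wasserstein distance (not its square) for the metric $|\mathcal C^{-1/2}(x-y)|$. If the Wasserstein distance is infinite, the right-hand side is $+\infty$. -/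

import Mathlib

open MeasureTheory ProbabilityTheory
open scoped ENNReal MatrixOrder

noncomputable section

namespace HitAndRun

/-- Euclidean space `ℝ^d` with its Euclidean norm. -/
abbrev Space (d : ℕ) := EuclideanSpace ℝ (Fin d)

/-- The unit sphere of `ℝ^d`. -/
abbrev USphere (d : ℕ) := Metric.sphere (0 : Space d) 1

/-- The uniform distribution on the unit sphere: the surface measure, normalized to mass one
(for `d ≥ 1`). -/
def uniformSphere (d : ℕ) : Measure (USphere d) :=
  ((volume : Measure (Space d)).toSphere Set.univ)⁻¹ • (volume : Measure (Space d)).toSphere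

/-! ### The Hit-and-Run sampler for a target with Lebesgue density `p` -/

/-- The scalar displacement measure on `ℝ`, with density in `h` proportional to `p (x + h v)`. -/
def displacement {d : ℕ} (p : Space d → ℝ≥0∞) (x v : Space d) : Measure ℝ :=
  (∫⁻ s : ℝ, p (x + s • v))⁻¹ • (volume : Measure ℝ).withDensity (fun h => p (x + h • v))

/-- The conditional distribution of the target on the line `{x + h v : h ∈ ℝ}`: the image of the
displacement measure under `h ↦ x + h v`. -/
def lineConditional {d : ℕ} (p : Space d → ℝ≥0∞) (x v : Space d) : Measure (Space d) :=
  (displacement p x v).map (fun h : ℝ => x + h • v)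

theorem lineConditional_apply {d : ℕ} {p : Space d → ℝ≥0∞} (x v : Space d) {A : Set (Space d)}
    (hA : MeasurableSet A) :
    lineConditional p x v A = (∫⁻ s : ℝ, p (x + s • v))⁻¹ *
      ∫⁻ h : ℝ, ((fun h : ℝ => x + h • v) ⁻¹' A).indicator (fun h => p (x + h • v)) h := by
  have hm : Measurable (fun h : ℝ => x + h • v) := by fun_prop
  rw [lineConditional, Measure.map_apply hm hA, displacement, Measure.smul_apply, smul_eq_mul,
    withDensity_apply _ (hm hA), lintegral_indicator (hm hA)]

theorem measurable_lineConditional {d : ℕ} {p : Space d → ℝ≥0∞} (hp : Measurable p) :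
    Measurable (fun z : Space d × USphere d => lineConditional p z.1 z.2) := by
  refine Measure.measurable_of_measurable_coe _ fun A hA => ?_
  have hm : Measurable (fun w : (Space d × USphere d) × ℝ =>
      w.1.1 + w.2 • (w.1.2 : Space d)) := by fun_prop
  have h1 : Measurable (fun w : (Space d × USphere d) × ℝ =>
      p (w.1.1 + w.2 • (w.1.2 : Space d))) := hp.comp hm
  have h2 := h1.indicator (hm hA)
  simp only [lineConditional_apply _ _ hA]
  exact h1.lintegral_prod_right'.inv.mul h2.lintegral_prod_right'

/-- The Hit-and-Run transition kernel: from `x`, draw `v` uniformly on the sphere, then draw the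
next state from the conditional distribution of the target on the line through `x` in
direction `v`. -/
def hitAndRun {d : ℕ} (p : Space d → ℝ≥0∞) (hp : Measurable p) : Kernel (Space d) (Space d) where
  toFun x := (uniformSphere d).bind (fun v => lineConditional p x v)
  measurable' := by
    have hL := measurable_lineConditional hp
    have : SFinite (uniformSphere d) := by unfold uniformSphere; infer_instance
    refine Measure.measurable_of_measurable_coe _ fun A hA => ?_
    have h1 : Measurable (fun z : Space d × USphere d => lineConditional p z.1 z.2 A) :=
      (Measure.measurable_coe hA).comp hL
    have h2 : ∀ x : Space d, (uniformSphere d).bind (fun v => lineConditional p x v) A =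
        ∫⁻ v, lineConditional p x v A ∂(uniformSphere d) := fun x =>
      Measure.bind_apply hA (hL.comp measurable_prodMk_left).aemeasurable
    simp only [h2]
    exact h1.lintegral_prod_right'

/-- `π(x, A) = ∫_{S^{d-1}} ∫_ℝ 1_A(x + h v) μ_{x,v}(dh) σ(dv)`. -/
theorem hitAndRun_apply {d : ℕ} {p : Space d → ℝ≥0∞} (hp : Measurable p) (x : Space d)
    {A : Set (Space d)} (hA : MeasurableSet A) :
    hitAndRun p hp x A = ∫⁻ v : USphere d, ∫⁻ h : ℝ, A.indicator 1 (x + h • (v : Space d))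
      ∂(displacement p x v) ∂(uniformSphere d) := by
  have h1 : hitAndRun p hp x A = ∫⁻ v, lineConditional p x v A ∂(uniformSphere d) :=
    Measure.bind_apply hA
      ((measurable_lineConditional hp).comp measurable_prodMk_left).aemeasurable
  rw [h1]
  refine lintegral_congr fun v => ?_
  have hm : Measurable (fun h : ℝ => x + h • (v : Space d)) := by fun_prop
  rw [lineConditional, Measure.map_apply hm hA, ← lintegral_indicator_one (hm hA)]
  rfl

/-- The law `ν π^n` of the `n`-th state of the Markov chain with kernel `π` and initial law `ν`. -/
def lawAfter {Ω : Type*} [MeasurableSpace Ω] (π : Kernel Ω Ω) (ν : Measure Ω) (n : ℕ) :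
    Measure Ω :=
  (fun η : Measure Ω => η.bind π)^[n] ν

/-- Total variation distance `sup_A |μ A - η A|` of probability measures. -/
def tvDist {Ω : Type*} [MeasurableSpace Ω] (μ η : Measure Ω) : ℝ :=
  ⨆ A : {A : Set Ω // MeasurableSet A}, |μ.real A - η.real A|

/-- The mixing time `inf {n : TV(ν π^n, μ) ≤ ε}`, equal to `⊤` if there is no such `n`. -/
def mixingTime {Ω : Type*} [MeasurableSpace Ω] (π : Kernel Ω Ω) (μ ν : Measure Ω) (ε : ℝ) : ℕ∞ :=
  ⨅ (n : ℕ) (_ : tvDist (lawAfter π ν n) μ ≤ ε), (n : ℕ∞)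

/-! ### Centered Gaussian targets -/

/-- The Lebesgue density of the centered Gaussian measure with (positive definite)
covariance matrix `S`. -/
def gaussianDensity {d : ℕ} (S : Matrix (Fin d) (Fin d) ℝ) (x : Space d) : ℝ≥0∞ :=
  ENNReal.ofReal ((Real.sqrt ((2 * Real.pi) ^ d * S.det))⁻¹ *
    Real.exp (-(inner ℝ x (Matrix.toEuclideanCLM (𝕜 := ℝ) S⁻¹ x)) / 2))

theorem measurable_gaussianDensity {d : ℕ} (S : Matrix (Fin d) (Fin d) ℝ) :
    Measurable (gaussianDensity S) := by
  unfold gaussianDensity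
  fun_prop

/-- The linear map `x ↦ S^{-1/2} x`. -/
def invSqrt {d : ℕ} (S : Matrix (Fin d) (Fin d) ℝ) : Space d →L[ℝ] Space d :=
  Matrix.toEuclideanCLM (𝕜 := ℝ) (CFC.sqrt S⁻¹)

/-- The `L²`-Wasserstein distance with respect to the metric `|S^{-1/2} (x - y)|`: the infimum
over all couplings, with value `⊤` if every coupling has infinite cost. -/
def wasserstein {d : ℕ} (S : Matrix (Fin d) (Fin d) ℝ) (μ ν : Measure (Space d)) : ℝ≥0∞ :=
  (⨅ (q : Measure (Space d × Space d)) (_ : q.fst = μ) (_ : q.snd = ν),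
    ∫⁻ z, ENNReal.ofReal (‖invSqrt S (z.1 - z.2)‖ ^ 2) ∂q) ^ (1 / 2 : ℝ)

/-- The contraction rate
`ρ = (1/2) inf_{|ζ| = 1} E_{v ∼ Unif(S^{d-1})} (ζ · S^{-1/2} v / |S^{-1/2} v|)²`. -/
def rate {d : ℕ} (S : Matrix (Fin d) (Fin d) ℝ) : ℝ :=
  (1 / 2) * ⨅ ζ : USphere d, ∫ v : USphere d,
    (inner ℝ (ζ : Space d) (‖invSqrt S v‖⁻¹ • invSqrt S v)) ^ 2 ∂(uniformSphere d)

/-- The largest eigenvalue `M` of `S⁻¹`. -/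
def maxEig {d : ℕ} (S : Matrix (Fin d) (Fin d) ℝ) : ℝ := sSup (spectrum ℝ S⁻¹)

/-- The smallest eigenvalue `m` of `S⁻¹`. -/
def minEig {d : ℕ} (S : Matrix (Fin d) (Fin d) ℝ) : ℝ := sInf (spectrum ℝ S⁻¹)

/-- The condition number `κ = M / m` of `S⁻¹`. -/
def condNumber {d : ℕ} (S : Matrix (Fin d) (Fin d) ℝ) : ℝ := maxEig S / minEig S

end HitAndRun

end

/-! Write `J = S^{-1/2}` and follow the chain in the coordinates `J x`, where the target is standard
Gaussian. One step draws a unit vector `u = J v / |J v|`, keeps the part of `J x` orthogonal to `u`,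
and replaces the coordinate along `u` by a standard Gaussian `z` (`map_move`,
`hitAndRun_gaussianDensity`). The chain is thus a random affine recursion driven by independent
pairs `(v, z)`, and it leaves the target invariant (`multivariateGaussian_bind_hitAndRun`).

Contraction. If two copies share `(v, z)`, their difference in these coordinates is projected off
`u`, so its mean square shrinks by the factor `1 - 2ρ` (`lintegral_norm_sq_move_sub_le`). Applied
along any coupling of the target with `ν`, `n` steps bring the distance down to at most `exp (-ρ n)`
times its initial value.

Smoothing. A further `k = 3 d + 2` steps convert this distance into total variation. With the
directions frozen, if `y - x = ∑ cᵢ vᵢ`, shifting the innovations by a suitable vector `h` makes the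
path from `x` end where the path from `y` ends (`exists_shift_trajectory`), and shifting a Gaussian
vector by `h` costs at most `|h|` in total variation (`stdGaussian_le_shift`). It remains to
represent a unit vector `e` as `∑ cᵢ vᵢ` with `∑ cᵢ²` small on average. The optimal value
`controlCost` has mean at most one (`lintegral_controlCost_uniformSphere_le`): for Gaussian
directions an explicit choice of `c` gives an inverse chi-square moment, and a polar decomposition
passes to the sphere. Hence the `k`-step kernel is Lipschitz into total variation with constant `2 k
√κ` (`lintegral_trajectory_le`).

Together, the total variation after `3 d + 2 + n` steps is at most `2 (3 d + 2) √κ exp (-ρ n)` times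
the initial Wasserstein distance. Since `ρ ≤ 1 / (2 d)` (`rate_mul_dim_le`), the smoothing steps are
absorbed into a constant multiple of `ρ⁻¹`. -/

noncomputable section

namespace HitAndRun

/-! ### Standard Gaussian vectors: resampling, shifts, inverse moments. -/

section Gaussian

variable {E : Type*} [NormedAddCommGroup E] [InnerProductSpace ℝ E] [FiniteDimensional ℝ E]
  [MeasurableSpace E] [BorelSpace E]

/-- Replacing the coordinate of a standard Gaussian vector along a unit vector by an independent
standard Gaussian variable does not change its law. -/
theorem stdGaussian_map_resample {e : E} (he : ‖e‖ = 1) :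
    ((stdGaussian E).prod (gaussianReal 0 1)).map
      (fun p : E × ℝ => p.1 + (p.2 - inner ℝ p.1 e) • e) = stdGaussian E := by
  have hm : Measurable (fun p : E × ℝ => p.1 + (p.2 - inner ℝ p.1 e) • e) := by fun_prop
  have : IsProbabilityMeasure (((stdGaussian E).prod (gaussianReal 0 1)).map
      (fun p : E × ℝ => p.1 + (p.2 - inner ℝ p.1 e) • e)) :=
    Measure.isProbabilityMeasure_map hm.aemeasurable
  apply Measure.ext_of_charFun
  ext t
  rw [charFun_apply, integral_map hm.aemeasurable (by fun_prop)]
  have h1 : ∀ p : E × ℝ, Complex.exp (inner ℝ (p.1 + (p.2 - inner ℝ p.1 e) • e) t * Complex.I) =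
      Complex.exp (inner ℝ p.1 (t - inner ℝ t e • e) * Complex.I) *
        Complex.exp (inner ℝ p.2 (inner ℝ t e) * Complex.I) := by
    intro p
    rw [← Complex.exp_add, ← add_mul, ← Complex.ofReal_add]
    congr 3
    rw [inner_add_left, inner_smul_left, inner_sub_right, inner_smul_right, real_inner_comm t e]
    simp
    ring
  simp_rw [h1]
  rw [integral_prod_mul (fun p : E => Complex.exp (inner ℝ p (t - inner ℝ t e • e) * Complex.I))
    (fun s : ℝ => Complex.exp (inner ℝ s (inner ℝ t e) * Complex.I)), ← charFun_apply,
    ← charFun_apply, charFun_stdGaussian, charFun_stdGaussian, charFun_gaussianReal,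
    ← Complex.exp_add]
  congr 1
  have h2 : ‖t - inner ℝ t e • e‖ ^ 2 = ‖t‖ ^ 2 - inner ℝ t e ^ 2 := by
    rw [norm_sub_sq_real, inner_smul_right, norm_smul, he]
    simp
    ring
  rw [← Complex.ofReal_pow, h2]
  push_cast
  simp
  ring

theorem gaussianPDFReal_le_one (μ x : ℝ) : gaussianPDFReal μ 1 x ≤ 1 := by
  rw [gaussianPDFReal]
  have h1 : (√(2 * Real.pi * (1 : NNReal)))⁻¹ ≤ 1 := by
    apply inv_le_one_of_one_le₀
    rw [Real.one_le_sqrt]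
    have := Real.pi_gt_three
    push_cast
    linarith
  have h2 : Real.exp (-(x - μ) ^ 2 / (2 * (1 : NNReal))) ≤ 1 := by
    rw [Real.exp_le_one_iff]
    push_cast
    nlinarith [sq_nonneg (x - μ)]
  calc _ ≤ (1 : ℝ) * 1 := by gcongr
    _ = 1 := by norm_num

/-- The two densities cross at `t / 2`, so the half-line below `t / 2` is the worst set. There the
masses differ by the standard Gaussian mass of an interval of length `t`, and the density is at most
one. -/
theorem gaussianReal_le_of_shift_nonneg {t : ℝ} (ht : 0 ≤ t) {A : Set ℝ} (hA : MeasurableSet A) :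
    gaussianReal 0 1 A ≤ gaussianReal t 1 A + ENNReal.ofReal t := by
  have hI : MeasurableSet (Set.Iio (t / 2)) := measurableSet_Iio
  have h1 : gaussianReal 0 1 (A \ Set.Iio (t / 2)) ≤ gaussianReal t 1 (A \ Set.Iio (t / 2)) := by
    rw [gaussianReal_apply _ one_ne_zero, gaussianReal_apply _ one_ne_zero]
    refine setLIntegral_mono (measurable_gaussianPDF _ _) fun x hx => ?_
    rw [gaussianPDF, gaussianPDF]
    refine ENNReal.ofReal_le_ofReal ?_
    rw [gaussianPDFReal, gaussianPDFReal]
    have hx' : t / 2 ≤ x := by simpa using hx.2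
    gcongr _ * Real.exp (-?_ / _)
    nlinarith
  have h2 : gaussianReal t 1 (Set.Iio (t / 2) \ A) ≤ gaussianReal 0 1 (Set.Iio (t / 2) \ A) := by
    rw [gaussianReal_apply _ one_ne_zero, gaussianReal_apply _ one_ne_zero]
    refine setLIntegral_mono (measurable_gaussianPDF _ _) fun x hx => ?_
    rw [gaussianPDF, gaussianPDF]
    refine ENNReal.ofReal_le_ofReal ?_
    rw [gaussianPDFReal, gaussianPDFReal]
    have hx' : x < t / 2 := by simpa using hx.1
    gcongr _ * Real.exp (-?_ / _)
    nlinarith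
  have h3 : gaussianReal 0 1 (Set.Iio (t / 2)) ≤
      gaussianReal t 1 (Set.Iio (t / 2)) + ENNReal.ofReal t := by
    have e1 : gaussianReal t 1 (Set.Iio (t / 2)) = gaussianReal 0 1 (Set.Iio (-(t / 2))) := by
      have : gaussianReal t 1 = (gaussianReal 0 1).map (· + t) := by
        rw [gaussianReal_map_add_const]; simp
      rw [this, Measure.map_apply (by fun_prop) hI]
      congr 1
      ext x
      simp only [Set.mem_preimage, Set.mem_Iio]
      constructor <;> intro h <;> linarith
    rw [e1]
    have e2 : Set.Iio (t / 2) = Set.Iio (-(t / 2)) ∪ Set.Ico (-(t / 2)) (t / 2) :=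
      (Set.Iio_union_Ico_eq_Iio (by linarith)).symm
    rw [e2]
    refine (measure_union_le _ _).trans (add_le_add le_rfl ?_)
    rw [gaussianReal_apply _ one_ne_zero]
    calc ∫⁻ x in Set.Ico (-(t / 2)) (t / 2), gaussianPDF 0 1 x
        ≤ ∫⁻ x in Set.Ico (-(t / 2)) (t / 2), 1 := by
          refine lintegral_mono fun x => ?_
          rw [gaussianPDF, ← ENNReal.ofReal_one]
          exact ENNReal.ofReal_le_ofReal (gaussianPDFReal_le_one 0 x)
      _ = ENNReal.ofReal t := by
          rw [setLIntegral_one, Real.volume_Ico]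
          congr 1
          ring
  have f1 := measure_inter_add_sdiff (μ := gaussianReal 0 1) A hI
  have f2 := measure_inter_add_sdiff (μ := gaussianReal t 1) A hI
  have f3 := measure_inter_add_sdiff (μ := gaussianReal 0 1) (Set.Iio (t / 2)) hA
  have f4 := measure_inter_add_sdiff (μ := gaussianReal t 1) (Set.Iio (t / 2)) hA
  rw [Set.inter_comm] at f3 f4
  have key : gaussianReal 0 1 (A ∩ Set.Iio (t / 2)) ≤
      gaussianReal t 1 (A ∩ Set.Iio (t / 2)) + ENNReal.ofReal t := by
    have hfin : gaussianReal t 1 (Set.Iio (t / 2) \ A) ≠ ∞ := measure_ne_top _ _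
    refine (ENNReal.add_le_add_iff_right hfin).1 ?_
    calc _ ≤ gaussianReal 0 1 (A ∩ Set.Iio (t / 2)) + gaussianReal 0 1 (Set.Iio (t / 2) \ A) :=
          add_le_add le_rfl h2
      _ = gaussianReal 0 1 (Set.Iio (t / 2)) := f3
      _ ≤ gaussianReal t 1 (Set.Iio (t / 2)) + ENNReal.ofReal t := h3
      _ = _ := by rw [← f4]; ring
  calc gaussianReal 0 1 A = _ := f1.symm
    _ ≤ (gaussianReal t 1 (A ∩ Set.Iio (t / 2)) + ENNReal.ofReal t) +
        gaussianReal t 1 (A \ Set.Iio (t / 2)) := add_le_add key h1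
    _ = gaussianReal t 1 A + ENNReal.ofReal t := by rw [← f2]; ring

/-- Resampling the coordinate along `h` and applying Fubini reduces this to the one-dimensional
shift by `‖h‖`, with no dependence on the dimension. -/
theorem stdGaussian_le_shift (h : E) {A : Set E} (hA : MeasurableSet A) :
    stdGaussian E A ≤ stdGaussian E ((fun x => x + h) ⁻¹' A) + ENNReal.ofReal ‖h‖ := by
  rcases eq_or_ne h 0 with rfl | hh
  · simp
  set e : E := ‖h‖⁻¹ • h with he_def
  have hn : ‖h‖ ≠ 0 := norm_ne_zero_iff.2 hh
  have he : ‖e‖ = 1 := by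
    rw [he_def, norm_smul, norm_inv, norm_norm, inv_mul_cancel₀ hn]
  have hhe : h = ‖h‖ • e := by rw [he_def, smul_smul, mul_inv_cancel₀ hn, one_smul]
  have hm : Measurable (fun p : E × ℝ => p.1 + (p.2 - inner ℝ p.1 e) • e) := by fun_prop
  have hA' : MeasurableSet ((fun x => x + h) ⁻¹' A) := (measurable_add_const h) hA
  have key : ∀ B : Set E, MeasurableSet B → stdGaussian E B = ∫⁻ p, gaussianReal 0 1
      {s : ℝ | p + (s - inner ℝ p e) • e ∈ B} ∂(stdGaussian E) := by
    intro B hB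
    conv_lhs => rw [← stdGaussian_map_resample he, Measure.map_apply hm hB,
      Measure.prod_apply (hm hB)]
    rfl
  rw [key A hA, key _ hA']
  calc ∫⁻ p, gaussianReal 0 1 {s : ℝ | p + (s - inner ℝ p e) • e ∈ A} ∂(stdGaussian E)
      ≤ ∫⁻ p, (gaussianReal 0 1 {s : ℝ | p + (s - inner ℝ p e) • e ∈ (fun x => x + h) ⁻¹' A} +
        ENNReal.ofReal ‖h‖) ∂(stdGaussian E) := by
        refine lintegral_mono fun p => ?_
        have hms : MeasurableSet {s : ℝ | p + (s - inner ℝ p e) • e ∈ A} :=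
          (hm.comp measurable_prodMk_left) hA
        refine (gaussianReal_le_of_shift_nonneg (norm_nonneg h) hms).trans_eq ?_
        congr 1
        have : gaussianReal ‖h‖ 1 = (gaussianReal 0 1).map (· + ‖h‖) := by
          rw [gaussianReal_map_add_const]; simp
        rw [this, Measure.map_apply (by fun_prop) hms]
        congr 1
        ext s
        simp only [Set.mem_preimage, Set.mem_ofPred_eq]
        conv_rhs => rw [hhe]
        rw [show p + (s + ‖h‖ - inner ℝ p e) • e = p + (s - inner ℝ p e) • e + ‖h‖ • e by module]
    _ = _ := by
        rw [lintegral_add_right _ measurable_const]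
        simp

theorem pi_gaussianReal_le_shift {ι : Type*} [Fintype ι] (h : ι → ℝ) {A : Set (ι → ℝ)}
    (hA : MeasurableSet A) :
    Measure.pi (fun _ : ι => gaussianReal 0 1) A ≤
      Measure.pi (fun _ : ι => gaussianReal 0 1) ((fun x => x + h) ⁻¹' A) +
        ENNReal.ofReal (√(∑ i, h i ^ 2)) := by
  have hT : Measurable (WithLp.ofLp : EuclideanSpace ℝ ι → ι → ℝ) := by fun_prop
  have hT' : Measurable (WithLp.toLp 2 : (ι → ℝ) → EuclideanSpace ℝ ι) := by fun_prop
  have key : ∀ B : Set (ι → ℝ), MeasurableSet B → Measure.pi (fun _ : ι => gaussianReal 0 1) B =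
      stdGaussian (EuclideanSpace ℝ ι) (WithLp.ofLp ⁻¹' B) := by
    intro B hB
    rw [← map_pi_eq_stdGaussian, Measure.map_apply hT' (hT hB)]
    rfl
  have hA' : MeasurableSet ((fun x => x + h) ⁻¹' A) := (measurable_add_const h) hA
  rw [key A hA, key _ hA']
  refine (stdGaussian_le_shift (WithLp.toLp 2 h) (hT hA)).trans_eq ?_
  congr 2
  rw [EuclideanSpace.norm_eq]
  simp

/-- The coordinates of a standard Gaussian vector in an orthonormal system are independent standard
Gaussian variables. -/
theorem map_inner_orthonormal {ι κ : Type*} [Fintype ι] [Fintype κ]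
    {b : κ → EuclideanSpace ℝ ι} (hb : Orthonormal ℝ b) :
    (Measure.pi (fun _ : ι => gaussianReal 0 1)).map
      (fun s (j : κ) => inner ℝ (b j) (WithLp.toLp 2 s)) =
    Measure.pi (fun _ : κ => gaussianReal 0 1) := by
  have hm : Measurable (fun (s : ι → ℝ) (j : κ) => inner ℝ (b j) (WithLp.toLp 2 s)) := by fun_prop
  have h1 : (Measure.pi (fun _ : ι => gaussianReal 0 1)).map
      (fun s => WithLp.toLp 2 (fun j : κ => inner ℝ (b j) (WithLp.toLp 2 s))) =
      stdGaussian (EuclideanSpace ℝ κ) := by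
    have hm2 : Measurable (fun s : ι → ℝ =>
        WithLp.toLp 2 (fun j : κ => inner ℝ (b j) (WithLp.toLp 2 s))) := by fun_prop
    have : IsProbabilityMeasure ((Measure.pi (fun _ : ι => gaussianReal 0 1)).map
      (fun s => WithLp.toLp 2 (fun j : κ => inner ℝ (b j) (WithLp.toLp 2 s)))) :=
      Measure.isProbabilityMeasure_map hm2.aemeasurable
    apply Measure.ext_of_charFun
    ext t
    rw [charFun_stdGaussian, charFun_apply, integral_map hm2.aemeasurable (by fun_prop)]
    have h2 : ∀ s : ι → ℝ, inner ℝ (WithLp.toLp 2 (fun j : κ => inner ℝ (b j) (WithLp.toLp 2 s))) t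
        = inner ℝ (WithLp.toLp 2 s) (∑ j, t j • b j) := by
      intro s
      rw [inner_sum, PiLp.inner_apply]
      refine Finset.sum_congr rfl fun j _ => ?_
      rw [inner_smul_right, real_inner_comm (b j)]
      simp
    simp_rw [h2]
    have h3 : ∫ s : ι → ℝ, Complex.exp (inner ℝ (WithLp.toLp 2 s) (∑ j, t j • b j) * Complex.I)
        ∂(Measure.pi (fun _ : ι => gaussianReal 0 1)) =
        charFun (stdGaussian (EuclideanSpace ℝ ι)) (∑ j, t j • b j) := by
      rw [← map_pi_eq_stdGaussian, charFun_apply, integral_map (by fun_prop) (by fun_prop)]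
    rw [h3, charFun_stdGaussian]
    have h5 : ‖∑ j, t j • b j‖ ^ 2 = ‖t‖ ^ 2 := by
      rw [← real_inner_self_eq_norm_sq, hb.inner_sum, EuclideanSpace.real_norm_sq_eq]
      simp [pow_two]
    rw [← Complex.ofReal_pow, h5, Complex.ofReal_pow]
  have hT : Measurable (WithLp.ofLp : EuclideanSpace ℝ κ → κ → ℝ) := by fun_prop
  have h4 := congrArg (Measure.map (WithLp.ofLp : EuclideanSpace ℝ κ → κ → ℝ)) h1
  rw [Measure.map_map hT (by fun_prop), ← map_pi_eq_stdGaussian,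
    Measure.map_map hT (by fun_prop)] at h4
  simpa [Function.comp_def] using h4

/-- The Laplace representation of `1 / x` replaces an inverse squared norm by exponentials, which
factor over coordinates. At `x = 0` both sides are infinite. -/
theorem inv_ofReal_le_lintegral_exp (x : ℝ) (hx : 0 ≤ x) :
    (ENNReal.ofReal x)⁻¹ ≤ ∫⁻ r in Set.Ioi (0 : ℝ), ENNReal.ofReal (Real.exp (-r * x)) := by
  rcases hx.eq_or_lt with rfl | hx
  · simp
  · have h := integral_exp_mul_Ioi (neg_lt_zero.2 hx) 0
    rw [← ENNReal.ofReal_inv_of_pos hx]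
    have h2 : ∀ r : ℝ, Real.exp (-r * x) = Real.exp (-x * r) := fun r => by ring_nf
    simp_rw [h2]
    rw [← ofReal_integral_eq_lintegral_ofReal (integrableOn_exp_mul_Ioi (neg_lt_zero.2 hx) 0)
      (ae_of_all _ fun r => (Real.exp_pos _).le), h]
    refine le_of_eq ?_
    congr 1
    simp

theorem integral_exp_neg_mul_sq_gaussianReal {r : ℝ} (hr : 0 ≤ r) :
    ∫ x, Real.exp (-r * x ^ 2) ∂(gaussianReal 0 1) = √((1 + 2 * r)⁻¹) := by
  rw [integral_gaussianReal_eq_integral_smul one_ne_zero]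
  have h : ∀ x : ℝ, gaussianPDFReal 0 1 x • Real.exp (-r * x ^ 2) =
      (√(2 * Real.pi))⁻¹ * Real.exp (-(1 / 2 + r) * x ^ 2) := by
    intro x
    rw [gaussianPDFReal, smul_eq_mul, mul_assoc, ← Real.exp_add]
    simp
    left
    ring_nf
  simp_rw [h]
  rw [integral_const_mul, integral_gaussian, ← Real.sqrt_inv, ← Real.sqrt_mul (by positivity)]
  congr 1
  have := Real.pi_pos
  field_simp

/-- Each coordinate contributes `(1 + 2 r)^{-1/2}`; the even dimension turns the product into an
integer power. -/
theorem lintegral_exp_neg_mul_sum_sq (q : ℕ) {r : ℝ} (hr : 0 ≤ r) :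
    ∫⁻ t, ENNReal.ofReal (Real.exp (-r * ∑ j, t j ^ 2))
      ∂(Measure.pi (fun _ : Fin (2 * q + 2) => gaussianReal 0 1)) =
    ENNReal.ofReal (((1 + 2 * r) ^ (q + 1))⁻¹) := by
  have h1 : ∀ t : Fin (2 * q + 2) → ℝ, Real.exp (-r * ∑ j, t j ^ 2) =
      ∏ j, Real.exp (-r * t j ^ 2) := fun t => by rw [Finset.mul_sum, Real.exp_sum]
  have hint : Integrable (fun t : Fin (2 * q + 2) → ℝ => Real.exp (-r * ∑ j, t j ^ 2))
      (Measure.pi (fun _ => gaussianReal 0 1)) := by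
    refine Integrable.of_bound (Measurable.aestronglyMeasurable (by fun_prop)) 1 (ae_of_all _ fun t => ?_)
    rw [Real.norm_of_nonneg (Real.exp_pos _).le, Real.exp_le_one_iff]
    have : 0 ≤ ∑ j, t j ^ 2 := Finset.sum_nonneg fun j _ => sq_nonneg _
    nlinarith
  rw [← ofReal_integral_eq_lintegral_ofReal hint (ae_of_all _ fun t => (Real.exp_pos _).le)]
  simp_rw [h1]
  rw [integral_fintype_prod_eq_prod (f := fun _ x => Real.exp (-r * x ^ 2))]
  simp_rw [integral_exp_neg_mul_sq_gaussianReal hr]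
  rw [Finset.prod_const, Finset.card_univ, Fintype.card_fin,
    show 2 * q + 2 = 2 * (q + 1) by ring, pow_mul, Real.sq_sqrt (by positivity), inv_pow]

/-- The inverse second moment of the norm of a standard Gaussian vector in dimension `2 q + 2`. -/
theorem lintegral_inv_sum_sq_le {q : ℕ} (hq : 0 < q) :
    ∫⁻ t, (ENNReal.ofReal (∑ j, t j ^ 2))⁻¹
      ∂(Measure.pi (fun _ : Fin (2 * q + 2) => gaussianReal 0 1)) ≤
    ENNReal.ofReal ((2 * q : ℝ)⁻¹) := by
  have hq' : (0 : ℝ) < q := by exact_mod_cast hq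
  calc _ ≤ ∫⁻ t, (∫⁻ r in Set.Ioi (0 : ℝ), ENNReal.ofReal (Real.exp (-r * ∑ j, t j ^ 2)))
        ∂(Measure.pi (fun _ : Fin (2 * q + 2) => gaussianReal 0 1)) :=
        lintegral_mono fun t =>
          inv_ofReal_le_lintegral_exp _ (Finset.sum_nonneg fun j _ => sq_nonneg _)
    _ = ∫⁻ r in Set.Ioi (0 : ℝ), ∫⁻ t, ENNReal.ofReal (Real.exp (-r * ∑ j, t j ^ 2))
        ∂(Measure.pi (fun _ : Fin (2 * q + 2) => gaussianReal 0 1)) :=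
        lintegral_lintegral_swap (Measurable.aemeasurable (by fun_prop))
    _ = ∫⁻ r in Set.Ioi (0 : ℝ), ENNReal.ofReal (((1 + 2 * r) ^ (q + 1))⁻¹) :=
        setLIntegral_congr_fun measurableSet_Ioi fun r hr =>
          lintegral_exp_neg_mul_sum_sq q (le_of_lt hr)
    _ = ENNReal.ofReal ((2 * q : ℝ)⁻¹) := by
        -- This antiderivative vanishes at infinity because `q > 0`, and its value at zero is minus
        -- the claimed constant.
        have hd : ∀ r ∈ Set.Ici (0 : ℝ), HasDerivAt
            (fun r : ℝ => -(2 * q : ℝ)⁻¹ * ((1 + 2 * r) ^ q)⁻¹) (((1 + 2 * r) ^ (q + 1))⁻¹) r := by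
          intro r hr
          have hr0 : (0 : ℝ) ≤ r := hr
          have hne : (1 + 2 * r) ≠ 0 := by positivity
          have h1 : HasDerivAt (fun r : ℝ => 1 + 2 * r) 2 r := by
            simpa using ((hasDerivAt_id r).const_mul 2).const_add 1
          refine (((h1.fun_pow q).fun_inv (pow_ne_zero q hne)).const_mul
            (-(2 * q : ℝ)⁻¹)).congr_deriv ?_
          obtain ⟨p, rfl⟩ : ∃ p, q = p + 1 := ⟨q - 1, by omega⟩
          rw [Nat.add_sub_cancel]
          field_simp
          ring
        have hlim : Filter.Tendsto (fun r : ℝ => -(2 * q : ℝ)⁻¹ * ((1 + 2 * r) ^ q)⁻¹)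
            Filter.atTop (nhds 0) := by
          have h1 : Filter.Tendsto (fun r : ℝ => 1 + 2 * r) Filter.atTop Filter.atTop :=
            Filter.tendsto_atTop_add_const_left _ _
              (Filter.tendsto_id.const_mul_atTop (by norm_num))
          have h2 := ((Filter.tendsto_pow_atTop hq.ne').comp h1).inv_tendsto_atTop
          simpa using h2.const_mul (-(2 * q : ℝ)⁻¹)
        have hnn : ∀ r ∈ Set.Ioi (0 : ℝ), 0 ≤ ((1 + 2 * r) ^ (q + 1))⁻¹ := by
          intro r hr
          have hr0 : (0 : ℝ) < r := hr
          positivity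
        rw [← ofReal_integral_eq_lintegral_ofReal (integrableOn_Ioi_deriv_of_nonneg' hd hnn hlim)
          ((ae_restrict_iff' measurableSet_Ioi).2 (ae_of_all _ hnn)),
          integral_Ioi_of_hasDerivAt_of_nonneg' hd hnn hlim]
        simp

end Gaussian

/-! ### The map `S^{-1/2}` and its spectral bounds. -/

section InvSqrt

variable {d : ℕ} {S : Matrix (Fin d) (Fin d) ℝ}

theorem inner_invSqrt (hS : S.PosDef) (x y : Space d) :
    inner ℝ (invSqrt S x) (invSqrt S y) = inner ℝ x (Matrix.toEuclideanCLM (𝕜 := ℝ) S⁻¹ y) := by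
  have hS' : (0 : Matrix (Fin d) (Fin d) ℝ) ≤ S⁻¹ := hS.inv.posSemidef.nonneg
  have hsa : IsSelfAdjoint (invSqrt S) := (CFC.sqrt_nonneg S⁻¹).isSelfAdjoint.map _
  rw [← ContinuousLinearMap.adjoint_inner_right, hsa.adjoint_eq, ← ContinuousLinearMap.comp_apply,
    ← ContinuousLinearMap.mul_def, invSqrt, ← map_mul, CFC.sqrt_mul_sqrt_self _ hS']

/-- Makes `invSqrt S` the inverse of the square root that defines `multivariateGaussian`. -/
theorem sqrt_inv_eq_inv_sqrt (hS : S.PosDef) : CFC.sqrt S⁻¹ = (CFC.sqrt S)⁻¹ := by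
  apply CFC.sqrt_unique
  · rw [← Matrix.mul_inv_rev, CFC.sqrt_mul_sqrt_self _ hS.posSemidef.nonneg]
  · exact (Matrix.nonneg_iff_posSemidef.1 (CFC.sqrt_nonneg S)).inv.nonneg

theorem isUnit_det_sqrt (hS : S.PosDef) : IsUnit (CFC.sqrt S).det := by
  have h := hS.det_pos
  rw [← CFC.sqrt_mul_sqrt_self S hS.posSemidef.nonneg, Matrix.det_mul] at h
  rw [isUnit_iff_ne_zero]
  rintro h0
  simp [h0] at h

theorem invSqrt_sqrt (hS : S.PosDef) (x : Space d) :
    invSqrt S (Matrix.toEuclideanCLM (𝕜 := ℝ) (CFC.sqrt S) x) = x := by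
  rw [invSqrt, ← ContinuousLinearMap.comp_apply, ← ContinuousLinearMap.mul_def, ← map_mul,
    sqrt_inv_eq_inv_sqrt hS, Matrix.nonsing_inv_mul _ (isUnit_det_sqrt hS), map_one]
  rfl

theorem sqrt_invSqrt (hS : S.PosDef) (x : Space d) :
    Matrix.toEuclideanCLM (𝕜 := ℝ) (CFC.sqrt S) (invSqrt S x) = x := by
  rw [invSqrt, ← ContinuousLinearMap.comp_apply, ← ContinuousLinearMap.mul_def, ← map_mul,
    sqrt_inv_eq_inv_sqrt hS, Matrix.mul_nonsing_inv _ (isUnit_det_sqrt hS), map_one]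
  rfl

theorem invSqrt_ne_zero (hS : S.PosDef) {x : Space d} (hx : x ≠ 0) : invSqrt S x ≠ 0 := by
  intro h
  apply hx
  rw [← sqrt_invSqrt hS x, h, map_zero]

theorem norm_invSqrt_sq (hS : S.PosDef) (x : Space d) :
    ‖invSqrt S x‖ ^ 2 = inner ℝ x (Matrix.toEuclideanCLM (𝕜 := ℝ) S⁻¹ x) := by
  rw [← real_inner_self_eq_norm_sq, inner_invSqrt hS]

theorem inner_toEuclideanCLM_le_of_le {A B : Matrix (Fin d) (Fin d) ℝ} (h : A ≤ B) (x : Space d) :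
    inner ℝ x (Matrix.toEuclideanCLM (𝕜 := ℝ) A x) ≤
      inner ℝ x (Matrix.toEuclideanCLM (𝕜 := ℝ) B x) := by
  have h1 := (Matrix.le_iff.1 h).dotProduct_mulVec_nonneg x.ofLp
  rw [Matrix.sub_mulVec, dotProduct_sub] at h1
  rw [Matrix.inner_toEuclideanCLM, Matrix.inner_toEuclideanCLM]
  simpa using h1

theorem norm_invSqrt_sq_le (hS : S.PosDef) (x : Space d) :
    ‖invSqrt S x‖ ^ 2 ≤ maxEig S * ‖x‖ ^ 2 := by
  have h : S⁻¹ ≤ algebraMap ℝ _ (maxEig S) :=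
    le_algebraMap_of_spectrum_le (fun r hr => le_csSup (Matrix.finite_spectrum _).bddAbove hr)
      hS.inv.isHermitian
  have h2 := inner_toEuclideanCLM_le_of_le h x
  rw [norm_invSqrt_sq hS]
  refine h2.trans_eq ?_
  rw [AlgHomClass.commutes, Algebra.algebraMap_eq_smul_one]
  simp [inner_smul_right]

theorem le_norm_invSqrt_sq (hS : S.PosDef) (x : Space d) :
    minEig S * ‖x‖ ^ 2 ≤ ‖invSqrt S x‖ ^ 2 := by
  have h : algebraMap ℝ _ (minEig S) ≤ S⁻¹ :=
    algebraMap_le_of_le_spectrum (fun r hr => csInf_le (Matrix.finite_spectrum _).bddBelow hr)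
      hS.inv.isHermitian
  have h2 := inner_toEuclideanCLM_le_of_le h x
  rw [norm_invSqrt_sq hS]
  refine Eq.trans_le ?_ h2
  rw [AlgHomClass.commutes, Algebra.algebraMap_eq_smul_one]
  simp [inner_smul_right]

theorem spectrum_nonempty [NeZero d] (hS : S.PosDef) : (spectrum ℝ S⁻¹).Nonempty := by
  rw [hS.inv.isHermitian.spectrum_real_eq_range_eigenvalues]
  exact Set.range_nonempty _

theorem minEig_pos [NeZero d] (hS : S.PosDef) : 0 < minEig S := by
  have h := (spectrum_nonempty hS).csInf_mem (Matrix.finite_spectrum _)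
  have h2 := h
  rw [hS.inv.isHermitian.spectrum_real_eq_range_eigenvalues] at h2
  obtain ⟨i, hi⟩ := h2
  have := hS.inv.eigenvalues_pos i
  rw [hi] at this
  rwa [minEig, hS.inv.isHermitian.spectrum_real_eq_range_eigenvalues]

theorem minEig_le_maxEig [NeZero d] (hS : S.PosDef) : minEig S ≤ maxEig S := by
  obtain ⟨r, hr⟩ := spectrum_nonempty hS
  exact (csInf_le (Matrix.finite_spectrum _).bddBelow hr).trans (le_csSup (Matrix.finite_spectrum _).bddAbove hr)

end InvSqrt

/-! ### Hit-and-Run as a random affine recursion, and its invariant law. -/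

section Kernel

variable {d : ℕ}

/-- The state reached from `x` in direction `v` with standard Gaussian innovation `z`, for the
centered Gaussian target with precision matrix `Jᵀ J`. -/
def move (J : Space d →L[ℝ] Space d) (x v : Space d) (z : ℝ) : Space d :=
  x + ((z - inner ℝ (J x) (‖J v‖⁻¹ • J v)) * ‖J v‖⁻¹) • v

@[fun_prop]
theorem Measurable.move {α : Type*} [MeasurableSpace α] (J : Space d →L[ℝ] Space d)
    {x v : α → Space d} {z : α → ℝ} (hx : Measurable x) (hv : Measurable v)
    (hz : Measurable z) : Measurable (fun a => HitAndRun.move J (x a) (v a) (z a)) := by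
  unfold HitAndRun.move
  have h1 : Measurable (fun a => ‖J (v a)‖⁻¹) := by fun_prop
  exact hx.add (((hz.sub (by fun_prop)).mul h1).smul hv)

/-- When `J v ≠ 0`, this is a resampling along the unit vector `J v / |J v|`: the orthogonal part of
`J x` is kept and the coordinate becomes `z`. -/
theorem map_move (J : Space d →L[ℝ] Space d) (x v : Space d) (z : ℝ) :
    J (move J x v z) = J x + (z - inner ℝ (J x) (‖J v‖⁻¹ • J v)) • (‖J v‖⁻¹ • J v) := by
  rw [move, map_add, map_smul, mul_smul]

instance [NeZero d] : IsProbabilityMeasure (uniformSphere d) := by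
  have : Nontrivial (Space d) := by
    have : Nonempty (Fin d) := ⟨0⟩
    infer_instance
  have h0 : (volume : Measure (Space d)).toSphere Set.univ ≠ 0 := by
    rw [Measure.measure_univ_ne_zero]
    exact Measure.toSphere_ne_zero _
  exact ⟨by rw [uniformSphere, Measure.smul_apply, smul_eq_mul,
    ENNReal.inv_mul_cancel h0 (measure_ne_top _ _)]⟩

variable {S : Matrix (Fin d) (Fin d) ℝ}

/-- Completing the square in `h`; the factor `K` disappears when the line density is normalized. -/
theorem gaussianDensity_add_smul (hS : S.PosDef) (x : Space d) {v : Space d} (hv : v ≠ 0) :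
    ∃ K : ℝ, 0 < K ∧ ∀ h : ℝ, gaussianDensity S (x + h • v) = ENNReal.ofReal K *
      gaussianPDF (-inner ℝ (invSqrt S x) (invSqrt S v) / ‖invSqrt S v‖ ^ 2)
        (‖invSqrt S v‖₊ ^ 2)⁻¹ h := by
  have hJ : 0 < ‖invSqrt S v‖ := norm_pos_iff.2 (invSqrt_ne_zero hS hv)
  have hD : 0 < √((2 * Real.pi) ^ d * S.det) := by
    have := hS.det_pos
    have := Real.pi_pos
    positivity
  refine ⟨(√((2 * Real.pi) ^ d * S.det))⁻¹ * √(2 * Real.pi * (‖invSqrt S v‖ ^ 2)⁻¹) *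
    Real.exp (-(‖invSqrt S x‖ ^ 2) / 2 +
      inner ℝ (invSqrt S x) (invSqrt S v) ^ 2 / (2 * ‖invSqrt S v‖ ^ 2)), ?_, fun h => ?_⟩
  · have := Real.pi_pos
    positivity
  rw [gaussianDensity, gaussianPDF, ← ENNReal.ofReal_mul (by positivity), gaussianPDFReal]
  congr 1
  have hc : (((‖invSqrt S v‖₊ ^ 2)⁻¹ : NNReal) : ℝ) = (‖invSqrt S v‖ ^ 2)⁻¹ := rfl
  rw [hc, ← norm_invSqrt_sq hS, map_add, map_smul, norm_add_sq_real, norm_smul, inner_smul_right]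
  have hne : √(2 * Real.pi * (‖invSqrt S v‖ ^ 2)⁻¹) ≠ 0 := by
    have := Real.pi_pos
    positivity
  rw [mul_assoc, mul_assoc]
  congr 1
  rw [mul_left_comm (Real.exp _), mul_inv_cancel_left₀ hne, ← Real.exp_add]
  congr 1
  rw [mul_pow, Real.norm_eq_abs, sq_abs]
  field_simp
  ring

theorem displacement_gaussianDensity (hS : S.PosDef) (x : Space d) {v : Space d} (hv : v ≠ 0) :
    displacement (gaussianDensity S) x v =
      gaussianReal (-inner ℝ (invSqrt S x) (invSqrt S v) / ‖invSqrt S v‖ ^ 2)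
        (‖invSqrt S v‖₊ ^ 2)⁻¹ := by
  obtain ⟨K, hK, h⟩ := gaussianDensity_add_smul hS x hv
  have hvar : (‖invSqrt S v‖₊ ^ 2)⁻¹ ≠ 0 :=
    inv_ne_zero (pow_ne_zero 2 (nnnorm_ne_zero_iff.2 (invSqrt_ne_zero hS hv)))
  have hK0 : ENNReal.ofReal K ≠ 0 := (ENNReal.ofReal_pos.2 hK).ne'
  rw [displacement]
  simp_rw [h]
  rw [lintegral_const_mul _ (measurable_gaussianPDF _ _), lintegral_gaussianPDF_eq_one _ hvar,
    mul_one, gaussianReal_of_var_ne_zero _ hvar]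
  have : (fun h => ENNReal.ofReal K *
      gaussianPDF (-inner ℝ (invSqrt S x) (invSqrt S v) / ‖invSqrt S v‖ ^ 2)
        (‖invSqrt S v‖₊ ^ 2)⁻¹ h) = ENNReal.ofReal K •
      gaussianPDF (-inner ℝ (invSqrt S x) (invSqrt S v) / ‖invSqrt S v‖ ^ 2)
        (‖invSqrt S v‖₊ ^ 2)⁻¹ := rfl
  rw [this, withDensity_smul _ (measurable_gaussianPDF _ _), smul_smul,
    ENNReal.inv_mul_cancel hK0 ENNReal.ofReal_ne_top, one_smul]

theorem lineConditional_gaussianDensity (hS : S.PosDef) (x : Space d) {v : Space d} (hv : v ≠ 0) :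
    lineConditional (gaussianDensity S) x v =
      (gaussianReal 0 1).map (fun z => move (invSqrt S) x v z) := by
  have hJ : 0 < ‖invSqrt S v‖ := norm_pos_iff.2 (invSqrt_ne_zero hS hv)
  rw [lineConditional, displacement_gaussianDensity hS x hv]
  have h1 : gaussianReal (-inner ℝ (invSqrt S x) (invSqrt S v) / ‖invSqrt S v‖ ^ 2)
        (‖invSqrt S v‖₊ ^ 2)⁻¹ = ((gaussianReal 0 1).map (‖invSqrt S v‖⁻¹ * ·)).map
      (-inner ℝ (invSqrt S x) (invSqrt S v) / ‖invSqrt S v‖ ^ 2 + ·) := by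
    rw [gaussianReal_map_const_mul, gaussianReal_map_const_add]
    congr 1
    · simp
    · ext
      simp
  rw [h1, Measure.map_map (by fun_prop) (by fun_prop), Measure.map_map (by fun_prop) (by fun_prop)]
  congr 1
  ext1 z
  simp only [Function.comp_apply, move]
  congr 2
  rw [inner_smul_right]
  field_simp
  ring

/-- The law of the pair (direction, innovation) driving one step. -/
def innovation (d : ℕ) : Measure (USphere d × ℝ) := (uniformSphere d).prod (gaussianReal 0 1)

instance [NeZero d] : IsProbabilityMeasure (innovation d) := by
  unfold innovation
  infer_instance

theorem sphere_ne_zero (v : USphere d) : (v : Space d) ≠ 0 :=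
  ne_zero_of_mem_unit_sphere v

/-- The law of `(v, z)` does not depend on `x`, so the same pair can drive chains from different
starting points. -/
theorem hitAndRun_gaussianDensity (hS : S.PosDef) (x : Space d) :
    hitAndRun (gaussianDensity S) (measurable_gaussianDensity S) x =
      (innovation d).map (fun ω => move (invSqrt S) x ω.1 ω.2) := by
  have hm : Measurable (fun ω : USphere d × ℝ => move (invSqrt S) x ω.1 ω.2) := by fun_prop
  ext A hA
  have h1 : hitAndRun (gaussianDensity S) (measurable_gaussianDensity S) x A =
      ∫⁻ v, lineConditional (gaussianDensity S) x v A ∂(uniformSphere d) :=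
    Measure.bind_apply hA ((measurable_lineConditional (measurable_gaussianDensity S)).comp
      measurable_prodMk_left).aemeasurable
  rw [h1, Measure.map_apply hm hA, innovation, Measure.prod_apply (hm hA)]
  refine lintegral_congr fun v => ?_
  rw [lineConditional_gaussianDensity hS x (sphere_ne_zero v), Measure.map_apply (by fun_prop) hA]
  rfl

theorem lintegral_hitAndRun [NeZero d] (hS : S.PosDef) (x : Space d) {f : Space d → ℝ≥0∞}
    (hf : Measurable f) :
    ∫⁻ y, f y ∂(hitAndRun (gaussianDensity S) (measurable_gaussianDensity S) x) =
      ∫⁻ ω, f (move (invSqrt S) x ω.1 ω.2) ∂(innovation d) := by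
  rw [hitAndRun_gaussianDensity hS, lintegral_map hf (by fun_prop)]

/-- The state of the chain started from `x` after `k` steps driven by `ω`. -/
def trajectory (J : Space d →L[ℝ] Space d) :
    (k : ℕ) → Space d → (Fin k → USphere d × ℝ) → Space d
  | 0, x, _ => x
  | k + 1, x, ω => trajectory J k (move J x (ω 0).1 (ω 0).2) (fun i => ω i.succ)

theorem measurable_trajectory (J : Space d →L[ℝ] Space d) (k : ℕ) :
    Measurable (fun p : Space d × (Fin k → USphere d × ℝ) => trajectory J k p.1 p.2) := by
  induction k with
  | zero => exact measurable_fst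
  | succ k ih =>
    have h : Measurable (fun p : Space d × (Fin (k + 1) → USphere d × ℝ) =>
        (move J p.1 (p.2 0).1 (p.2 0).2, fun i : Fin k => p.2 i.succ)) := by fun_prop
    exact ih.comp h

theorem lintegral_pi_succ {α : Type*} [MeasurableSpace α] (μ : Measure α) [SigmaFinite μ] (k : ℕ)
    {f : α × (Fin k → α) → ℝ≥0∞} (hf : Measurable f) :
    ∫⁻ ω : Fin (k + 1) → α, f (ω 0, fun i => ω i.succ) ∂(Measure.pi fun _ => μ) =
      ∫⁻ a, ∫⁻ ω, f (a, ω) ∂(Measure.pi fun _ => μ) ∂μ := by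
  have h := measurePreserving_piFinSuccAbove (fun _ : Fin (k + 1) => μ) 0
  rw [← lintegral_prod _ hf.aemeasurable, ← h.lintegral_comp hf]
  rfl

theorem lintegral_lawAfter [NeZero d] (hS : S.PosDef) (k : ℕ) (η : Measure (Space d)) {f : Space d → ℝ≥0∞}
    (hf : Measurable f) :
    ∫⁻ y, f y ∂(lawAfter (hitAndRun (gaussianDensity S) (measurable_gaussianDensity S)) η k) =
      ∫⁻ x, ∫⁻ ω, f (trajectory (invSqrt S) k x ω) ∂(Measure.pi fun _ => innovation d) ∂η := by
  -- `trajectory` consumes its first innovation first, so the first step is peeled off and the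
  -- initial law must vary.
  induction k generalizing η with
  | zero => simp [lawAfter, trajectory]
  | succ k ih =>
    have hm := (hf.comp (measurable_trajectory (invSqrt S) k))
    have h1 : lawAfter (hitAndRun (gaussianDensity S) (measurable_gaussianDensity S)) η (k + 1) =
        lawAfter (hitAndRun (gaussianDensity S) (measurable_gaussianDensity S))
          (η.bind (hitAndRun (gaussianDensity S) (measurable_gaussianDensity S))) k := rfl
    have hm2 : Measurable (fun x => ∫⁻ ω, f (trajectory (invSqrt S) k x ω)
        ∂(Measure.pi fun _ => innovation d)) := hm.lintegral_prod_right'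
    rw [h1, ih, Measure.lintegral_bind (Kernel.aemeasurable _) hm2.aemeasurable]
    refine lintegral_congr fun x => ?_
    rw [lintegral_hitAndRun hS x hm2]
    have hm3 : Measurable (fun p : (USphere d × ℝ) × (Fin k → USphere d × ℝ) =>
        f (trajectory (invSqrt S) k (move (invSqrt S) x p.1.1 p.1.2) p.2)) := by
      have : Measurable (fun p : (USphere d × ℝ) × (Fin k → USphere d × ℝ) =>
          (move (invSqrt S) x p.1.1 p.1.2, p.2)) := by fun_prop
      exact hm.comp this
    exact (lintegral_pi_succ (innovation d) k hm3).symm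

/-- Invariance already holds for each fixed direction: pulled back by `S^{1/2}`, it is
`stdGaussian_map_resample`. -/
theorem lintegral_multivariateGaussian_move (hS : S.PosDef) {v : Space d} (hv : v ≠ 0)
    {f : Space d → ℝ≥0∞} (hf : Measurable f) :
    ∫⁻ x, ∫⁻ z, f (move (invSqrt S) x v z) ∂(gaussianReal 0 1) ∂(multivariateGaussian 0 S) =
      ∫⁻ x, f x ∂(multivariateGaussian 0 S) := by
  set J := invSqrt S
  set Q : Space d →L[ℝ] Space d := Matrix.toEuclideanCLM (𝕜 := ℝ) (CFC.sqrt S) with hQ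
  have hJv : J v ≠ 0 := invSqrt_ne_zero hS hv
  have hu : ‖‖J v‖⁻¹ • J v‖ = 1 := norm_smul_inv_norm (𝕜 := ℝ) hJv
  have hG : multivariateGaussian 0 S = (stdGaussian (Space d)).map Q := by
    rw [multivariateGaussian]
    simp [hQ]
  have hm : Measurable (fun p : Space d × ℝ => f (move J p.1 v p.2)) := hf.comp (by fun_prop)
  have hfQ : Measurable (fun a => f (Q a)) := hf.comp Q.continuous.measurable
  rw [hG, lintegral_map hm.lintegral_prod_right' (by fun_prop), lintegral_map hf (by fun_prop)]
  conv_rhs => rw [← stdGaussian_map_resample hu, lintegral_map hfQ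
    (by fun_prop), lintegral_prod _ (Measurable.aemeasurable (by fun_prop))]
  refine lintegral_congr fun p => lintegral_congr fun z => ?_
  congr 1
  have h1 : J (Q p) = p := invSqrt_sqrt hS p
  have h2 : Q (J v) = v := sqrt_invSqrt hS v
  rw [move, h1, map_add, map_smul, map_smul, h2, smul_smul]

theorem multivariateGaussian_bind_hitAndRun [NeZero d] (hS : S.PosDef) :
    (multivariateGaussian 0 S).bind
      (hitAndRun (gaussianDensity S) (measurable_gaussianDensity S)) =
      multivariateGaussian 0 S := by
  refine Measure.ext_of_lintegral _ fun f hf => ?_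
  rw [Measure.lintegral_bind (Kernel.aemeasurable _) hf.aemeasurable]
  simp_rw [lintegral_hitAndRun hS _ hf, innovation]
  have hm : Measurable (fun p : Space d × (USphere d × ℝ) =>
      f (move (invSqrt S) p.1 p.2.1 p.2.2)) := hf.comp (by fun_prop)
  have h1 : ∀ x : Space d, ∫⁻ ω, f (move (invSqrt S) x ω.1 ω.2)
      ∂((uniformSphere d).prod (gaussianReal 0 1)) = ∫⁻ v : USphere d, ∫⁻ z,
        f (move (invSqrt S) x v z) ∂(gaussianReal 0 1) ∂(uniformSphere d) := fun x =>
    lintegral_prod _ (hm.comp measurable_prodMk_left).aemeasurable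
  simp_rw [h1]
  have hm2 : Measurable (fun q : (Space d × USphere d) × ℝ =>
      f (move (invSqrt S) q.1.1 q.1.2 q.2)) := hf.comp (by fun_prop)
  rw [lintegral_lintegral_swap hm2.lintegral_prod_right'.aemeasurable]
  simp_rw [lintegral_multivariateGaussian_move hS (sphere_ne_zero _) hf]
  simp

theorem lawAfter_multivariateGaussian [NeZero d] (hS : S.PosDef) (k : ℕ) :
    lawAfter (hitAndRun (gaussianDensity S) (measurable_gaussianDensity S))
      (multivariateGaussian 0 S) k = multivariateGaussian 0 S :=
  Function.iterate_fixed (multivariateGaussian_bind_hitAndRun hS) k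

end Kernel

/-! ### Polar decomposition of the Gaussian and second moments on the sphere. -/

section Polar

/-- Only radial symmetry of the density matters later, so the constant is left implicit. The two
measures are identified through their characteristic functions. -/
theorem stdGaussian_eq_withDensity {E : Type*} [NormedAddCommGroup E] [InnerProductSpace ℝ E]
    [FiniteDimensional ℝ E] [MeasurableSpace E] [BorelSpace E] :
    ∃ K : ℝ, 0 ≤ K ∧ stdGaussian E =
      volume.withDensity (fun x => ENNReal.ofReal (K * Real.exp (-‖x‖ ^ 2 / 2))) := by
  set Z : ℝ := ∫ x : E, Real.exp (-‖x‖ ^ 2 / 2) with hZ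
  have hre : 0 < ((1 / 2 : ℂ)).re := by norm_num
  have hint : Integrable (fun x : E => Real.exp (-‖x‖ ^ 2 / 2)) := by
    have h := (GaussianFourier.integrable_cexp_neg_mul_sq_norm_add (V := E) hre 0 0).norm
    refine h.congr (ae_of_all _ fun x => ?_)
    simp only [Complex.norm_exp]
    congr 1
    simp [← Complex.ofReal_pow]
    ring
  have hZpos : 0 < Z := by
    rw [hZ, integral_pos_iff_support_of_nonneg (fun x => (Real.exp_pos _).le) hint]
    have : Function.support (fun x : E => Real.exp (-‖x‖ ^ 2 / 2)) = Set.univ := by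
      ext x; simp [Real.exp_ne_zero]
    rw [this]
    exact Measure.measure_univ_pos.2 (NeZero.ne _)
  refine ⟨Z⁻¹, by positivity, ?_⟩
  have hnn : ∀ x : E, 0 ≤ Z⁻¹ * Real.exp (-‖x‖ ^ 2 / 2) := fun x => by positivity
  have hmeas : Measurable (fun x : E => ENNReal.ofReal (Z⁻¹ * Real.exp (-‖x‖ ^ 2 / 2))) := by
    fun_prop
  have : IsProbabilityMeasure
      (volume.withDensity (fun x : E => ENNReal.ofReal (Z⁻¹ * Real.exp (-‖x‖ ^ 2 / 2)))) := by
    refine ⟨?_⟩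
    rw [withDensity_apply _ MeasurableSet.univ, Measure.restrict_univ,
      ← ofReal_integral_eq_lintegral_ofReal (hint.const_mul _) (ae_of_all _ hnn),
      integral_const_mul, ← hZ, inv_mul_cancel₀ hZpos.ne', ENNReal.ofReal_one]
  have hF : ∀ t : E, ∫ x : E, Complex.exp (inner ℝ x t * Complex.I) *
      (Real.exp (-‖x‖ ^ 2 / 2) : ℂ) =
      (Real.pi / (1 / 2 : ℂ)) ^ (Module.finrank ℝ E / 2 : ℂ) * Complex.exp (-‖t‖ ^ 2 / 2) := by
    intro t
    have h := GaussianFourier.integral_cexp_neg_mul_sq_norm_add (V := E) hre Complex.I t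
    rw [Complex.I_sq] at h
    convert! h using 2
    · ext x
      rw [Complex.ofReal_exp, ← Complex.exp_add, real_inner_comm]
      congr 1
      push_cast
      ring
    · congr 1
      ring
  have hZ2 : (Z : ℂ) = (Real.pi / (1 / 2 : ℂ)) ^ (Module.finrank ℝ E / 2 : ℂ) := by
    have h := hF 0
    simp only [inner_zero_right, Complex.ofReal_zero, zero_mul, Complex.exp_zero, one_mul,
      norm_zero] at h
    rw [integral_complex_ofReal, ← hZ] at h
    rw [h]
    simp
  apply Measure.ext_of_charFun
  ext t
  rw [charFun_stdGaussian, charFun_apply, integral_withDensity_eq_integral_toReal_smul hmeas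
    (ae_of_all _ fun x => ENNReal.ofReal_lt_top)]
  have h1 : ∀ x : E, (ENNReal.ofReal (Z⁻¹ * Real.exp (-‖x‖ ^ 2 / 2))).toReal •
      Complex.exp (inner ℝ x t * Complex.I) =
      (Z : ℂ)⁻¹ * (Complex.exp (inner ℝ x t * Complex.I) * (Real.exp (-‖x‖ ^ 2 / 2) : ℂ)) := by
    intro x
    rw [ENNReal.toReal_ofReal (hnn x), Complex.real_smul]
    push_cast
    ring
  simp_rw [h1]
  rw [integral_const_mul, hF, ← hZ2, ← mul_assoc, inv_mul_cancel₀, one_mul]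
  exact_mod_cast hZpos.ne'

theorem lintegral_sq_gaussianReal : ∫⁻ s, ENNReal.ofReal (s ^ 2) ∂(gaussianReal 0 1) = 1 := by
  have hi : Integrable (fun s : ℝ => s ^ 2) (gaussianReal 0 1) :=
    (memLp_id_gaussianReal (μ := 0) (v := 1) 2).integrable_sq
  rw [← ofReal_integral_eq_lintegral_ofReal hi (ae_of_all _ fun s => sq_nonneg s)]
  have h := variance_fun_id_gaussianReal (μ := 0) (v := 1)
  rw [variance_eq_integral (by fun_prop)] at h
  simp only [integral_id_gaussianReal, sub_zero] at h
  simp [h]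

theorem lintegral_inner_sq_stdGaussian {E : Type*} [NormedAddCommGroup E] [InnerProductSpace ℝ E]
    [FiniteDimensional ℝ E] [MeasurableSpace E] [BorelSpace E] {a : E} (ha : ‖a‖ = 1) :
    ∫⁻ x, ENNReal.ofReal (inner ℝ a x ^ 2) ∂(stdGaussian E) = 1 := by
  rw [← stdGaussian_map_resample ha, lintegral_map (by fun_prop) (by fun_prop)]
  have h1 : ∀ p : E × ℝ, inner ℝ a (p.1 + (p.2 - inner ℝ p.1 a) • a) = p.2 := by
    intro p
    rw [inner_add_right, inner_smul_right, real_inner_self_eq_norm_sq, ha, real_inner_comm]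
    ring
  simp_rw [h1]
  rw [lintegral_prod _ (by fun_prop)]
  simp [lintegral_sq_gaussianReal]

theorem lintegral_norm_sq_stdGaussian (d : ℕ) :
    ∫⁻ x, ENNReal.ofReal (‖x‖ ^ 2) ∂(stdGaussian (Space d)) = d := by
  have h1 : ∀ x : Space d, ENNReal.ofReal (‖x‖ ^ 2) =
      ∑ i, ENNReal.ofReal (inner ℝ (EuclideanSpace.basisFun (Fin d) ℝ i) x ^ 2) := by
    intro x
    rw [← ENNReal.ofReal_sum_of_nonneg fun i _ => sq_nonneg _,
      (EuclideanSpace.basisFun (Fin d) ℝ).sum_sq_inner_right]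
  simp_rw [h1]
  rw [lintegral_finsetSum _ (fun i _ => by fun_prop)]
  simp_rw [lintegral_inner_sq_stdGaussian ((EuclideanSpace.basisFun (Fin d) ℝ).norm_eq_one _)]
  simp

/-- The polar decomposition of the standard Gaussian measure: the direction is uniform on the
sphere and independent of the radius. -/
theorem exists_polar_stdGaussian (d : ℕ) [NeZero d] :
    ∃ Λ : Measure ℝ, IsProbabilityMeasure Λ ∧
      (Λ.prod (uniformSphere d)).map (fun p : ℝ × USphere d => p.1 • (p.2 : Space d)) =
        stdGaussian (Space d) ∧
      ∫⁻ r, ENNReal.ofReal (r ^ 2) ∂Λ = d := by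
  have : Nontrivial (Space d) := by
    have : Nonempty (Fin d) := ⟨0⟩
    infer_instance
  obtain ⟨K, hK, hG⟩ := stdGaussian_eq_withDensity (E := Space d)
  set τ := (volume : Measure (Space d)).toSphere with hτ
  have h0 : τ Set.univ ≠ 0 := by
    rw [Measure.measure_univ_ne_zero]
    exact Measure.toSphere_ne_zero _
  have htop : τ Set.univ ≠ ∞ := measure_ne_top _ _
  set f : ℝ → ℝ≥0∞ := fun r => ENNReal.ofReal (K * Real.exp (-r ^ 2 / 2)) with hf
  have hfm : Measurable f := by fun_prop
  set n := Module.finrank ℝ (Space d) - 1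
  set V := Measure.volumeIoiPow n
  -- The factor `τ Set.univ` compensates the normalization in `uniformSphere`.
  set Λ : Measure ℝ := (τ Set.univ • V.withDensity (fun r => f r)).map Subtype.val with hR
  have hfV : Measurable (fun r : Set.Ioi (0 : ℝ) => f r) := hfm.comp measurable_subtype_coe
  have hσm : SFinite (uniformSphere d) := inferInstance
  have key : ∀ F : Space d → ℝ≥0∞, Measurable F → ∫⁻ x, F x ∂(stdGaussian (Space d)) =
      ∫⁻ r, ∫⁻ v : USphere d, F (r • (v : Space d)) ∂(uniformSphere d) ∂Λ := by
    intro F hF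
    have hFm : Measurable (fun p : ℝ × USphere d => F (p.1 • (p.2 : Space d))) :=
      hF.comp (by fun_prop)
    have hm := Measure.measurePreserving_homeomorphUnitSphereProd (volume : Measure (Space d))
    rw [hG, lintegral_withDensity_eq_lintegral_mul _ (by fun_prop) hF]
    have hrestrict : (volume : Measure (Space d)).restrict {0}ᶜ = volume :=
      Measure.restrict_eq_self_of_ae_mem (compl_mem_ae_iff.2 (measure_singleton 0))
    have e1 : ∫⁻ x : Space d, ((fun x : Space d => ENNReal.ofReal (K * Real.exp (-‖x‖ ^ 2 / 2))) * F :
        Space d → ℝ≥0∞) x =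
        ∫⁻ x : ({0}ᶜ : Set (Space d)), f ‖(x : Space d)‖ * F x
          ∂((volume : Measure (Space d)).comap Subtype.val) := by
      rw [lintegral_subtype_comap (measurableSet_singleton _).compl
        (fun x : Space d => f ‖x‖ * F x),
        hrestrict]
      rfl
    have e2 : ∫⁻ x : ({0}ᶜ : Set (Space d)), f ‖(x : Space d)‖ * F x
          ∂((volume : Measure (Space d)).comap Subtype.val) =
        ∫⁻ p : USphere d × Set.Ioi (0 : ℝ), f p.2 * F ((p.2 : ℝ) • (p.1 : Space d))
          ∂(τ.prod V) := by
      rw [← hm.lintegral_comp_emb (homeomorphUnitSphereProd (Space d)).measurableEmbedding]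
      refine lintegral_congr fun x => ?_
      have hx : ‖(x : Space d)‖ ≠ 0 := norm_ne_zero_iff.2 x.2
      simp [smul_smul, hx]
    set g : ℝ → ℝ≥0∞ := fun r => ∫⁻ v : USphere d, F (r • (v : Space d)) ∂(uniformSphere d)
      with hg
    have hgm : Measurable g := hFm.lintegral_prod_right'
    have hgV : Measurable (fun r : Set.Ioi (0 : ℝ) => g r) := hgm.comp measurable_subtype_coe
    rw [e1, e2, hR, lintegral_map hgm measurable_subtype_coe,
      lintegral_smul_measure, lintegral_withDensity_eq_lintegral_mul _ hfV hgV]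
    have hFm2 : Measurable (fun p : USphere d × Set.Ioi (0 : ℝ) =>
        f p.2 * F ((p.2 : ℝ) • (p.1 : Space d))) :=
      (hfm.comp (by fun_prop)).mul (hF.comp (by fun_prop))
    rw [lintegral_prod_symm _ hFm2.aemeasurable, smul_eq_mul,
      ← lintegral_const_mul _ (hfV.mul hgV)]
    refine lintegral_congr fun r => ?_
    have hFr : Measurable (fun v : USphere d => F ((r : ℝ) • (v : Space d))) :=
      hF.comp (by fun_prop)
    simp only [Pi.mul_apply, hg]
    rw [lintegral_const_mul _ hFr, uniformSphere, lintegral_smul_measure, smul_eq_mul, ← hτ,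
      mul_left_comm, ← mul_assoc (τ Set.univ), ENNReal.mul_inv_cancel h0 htop, one_mul]
  have hΛp : IsProbabilityMeasure Λ := by
    have h := key (fun _ => 1) measurable_const
    simp only [lintegral_const, measure_univ, mul_one, one_mul] at h
    exact ⟨h.symm⟩
  refine ⟨Λ, hΛp, ?_, ?_⟩
  · refine Measure.ext_of_lintegral _ fun F hF => ?_
    have hFm : Measurable (fun p : ℝ × USphere d => F (p.1 • (p.2 : Space d))) :=
      hF.comp (by fun_prop)
    rw [lintegral_map hF (by fun_prop), lintegral_prod _ hFm.aemeasurable, key F hF]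
  · have h := key (fun x => ENNReal.ofReal (‖x‖ ^ 2)) (by fun_prop)
    rw [lintegral_norm_sq_stdGaussian] at h
    rw [h]
    refine lintegral_congr fun r => ?_
    simp [norm_smul]

/-- By independence of radius and direction, the Gaussian second moment `1` equals `d` times this
integral. -/
theorem lintegral_inner_sq_uniformSphere (d : ℕ) [NeZero d] {a : Space d} (ha : ‖a‖ = 1) :
    ∫⁻ v : USphere d, ENNReal.ofReal (inner ℝ a v ^ 2) ∂(uniformSphere d) = (d : ℝ≥0∞)⁻¹ := by
  obtain ⟨Λ, hΛ, hmap, hsq⟩ := exists_polar_stdGaussian d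
  have h := lintegral_inner_sq_stdGaussian ha
  rw [← hmap, lintegral_map (by fun_prop) (by fun_prop),
    lintegral_prod _ (Measurable.aemeasurable (by fun_prop))] at h
  simp_rw [inner_smul_right, mul_pow, ENNReal.ofReal_mul (sq_nonneg _)] at h
  have hm : Measurable (fun v : USphere d => ENNReal.ofReal (inner ℝ a (v : Space d) ^ 2)) := by
    fun_prop
  simp_rw [lintegral_const_mul _ hm] at h
  rw [lintegral_mul_const _ (by fun_prop), hsq] at h
  exact ENNReal.eq_inv_of_mul_eq_one_left (by rwa [mul_comm])

end Polar

/-! ### The rate `ρ` and contraction under the synchronous coupling. -/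

section Contraction

variable {d : ℕ} {S : Matrix (Fin d) (Fin d) ℝ}

theorem norm_dir (hS : S.PosDef) (v : USphere d) :
    ‖‖invSqrt S v‖⁻¹ • invSqrt S v‖ = 1 :=
  norm_smul_inv_norm (𝕜 := ℝ) (invSqrt_ne_zero hS (sphere_ne_zero v))

theorem measurable_dir (S : Matrix (Fin d) (Fin d) ℝ) :
    Measurable (fun v : USphere d => ‖invSqrt S v‖⁻¹ • invSqrt S v) := by
  have h : Measurable (fun v : USphere d => ‖invSqrt S v‖⁻¹) := by fun_prop
  fun_prop

theorem inner_dir_sq_le (hS : S.PosDef) (w : Space d) (v : USphere d) :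
    inner ℝ w (‖invSqrt S v‖⁻¹ • invSqrt S v) ^ 2 ≤ ‖w‖ ^ 2 := by
  have h := abs_real_inner_le_norm w (‖invSqrt S v‖⁻¹ • invSqrt S v)
  rw [norm_dir hS, mul_one] at h
  exact sq_le_sq' (neg_le_of_abs_le h) (le_of_abs_le h)

theorem two_mul_rate_le (S : Matrix (Fin d) (Fin d) ℝ) (ζ : USphere d) :
    2 * rate S ≤ ∫ v : USphere d,
      inner ℝ (ζ : Space d) (‖invSqrt S v‖⁻¹ • invSqrt S v) ^ 2 ∂(uniformSphere d) := by
  have h : ⨅ ζ : USphere d, ∫ v : USphere d,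
      (inner ℝ (ζ : Space d) (‖invSqrt S v‖⁻¹ • invSqrt S v)) ^ 2 ∂(uniformSphere d) ≤
      ∫ v : USphere d, inner ℝ (ζ : Space d) (‖invSqrt S v‖⁻¹ • invSqrt S v) ^ 2
        ∂(uniformSphere d) :=
    ciInf_le ⟨0, by
      rintro _ ⟨ζ, rfl⟩
      exact integral_nonneg fun v => sq_nonneg _⟩ ζ
  rw [rate]
  linarith

theorem inner_invSqrt_right (S : Matrix (Fin d) (Fin d) ℝ) (x y : Space d) :
    inner ℝ x (invSqrt S y) = inner ℝ (invSqrt S x) y := by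
  have hsa : IsSelfAdjoint (invSqrt S) := (CFC.sqrt_nonneg S⁻¹).isSelfAdjoint.map _
  rw [← ContinuousLinearMap.adjoint_inner_right, hsa.adjoint_eq]

/-- The shared innovation `z` cancels, leaving only the removal of the component along the
direction. -/
theorem invSqrt_move_sub (S : Matrix (Fin d) (Fin d) ℝ) (x y v : Space d) (z : ℝ) :
    invSqrt S (move (invSqrt S) x v z - move (invSqrt S) y v z) = invSqrt S (x - y) -
      inner ℝ (invSqrt S (x - y)) (‖invSqrt S v‖⁻¹ • invSqrt S v) •
        (‖invSqrt S v‖⁻¹ • invSqrt S v) := by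
  rw [map_sub, map_move, map_move, map_sub, inner_sub_left]
  module

theorem two_mul_rate_mul_norm_sq_le (S : Matrix (Fin d) (Fin d) ℝ) (w : Space d) :
    2 * rate S * ‖w‖ ^ 2 ≤ ∫ v : USphere d,
      inner ℝ w (‖invSqrt S v‖⁻¹ • invSqrt S v) ^ 2 ∂(uniformSphere d) := by
  rcases eq_or_ne w 0 with rfl | hw
  · simp
  have hn : ‖w‖ ≠ 0 := norm_ne_zero_iff.2 hw
  have hζ : ‖w‖⁻¹ • w ∈ Metric.sphere (0 : Space d) 1 := by
    rw [mem_sphere_zero_iff_norm]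
    exact norm_smul_inv_norm (𝕜 := ℝ) hw
  have h := two_mul_rate_le S ⟨_, hζ⟩
  simp only [inner_smul_left w, mul_pow] at h
  rw [integral_const_mul] at h
  simp only [map_inv₀, RCLike.conj_to_real] at h
  calc 2 * rate S * ‖w‖ ^ 2 ≤ _ := mul_le_mul_of_nonneg_right h (sq_nonneg _)
    _ = _ := by field_simp

variable [NeZero d]

theorem integrable_inner_dir_sq (hS : S.PosDef) (w : Space d) :
    Integrable (fun v : USphere d => inner ℝ w (‖invSqrt S v‖⁻¹ • invSqrt S v) ^ 2)
      (uniformSphere d) := by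
  have hm := measurable_dir S
  refine Integrable.of_bound (Measurable.aestronglyMeasurable (by fun_prop)) (‖w‖ ^ 2)
    (ae_of_all _ fun v => ?_)
  rw [Real.norm_of_nonneg (sq_nonneg _)]
  exact inner_dir_sq_le hS w v

/-- Summing the squared coordinates of a unit vector over an orthonormal basis gives one, while each
has mean at least `2ρ`. This lets `ρ⁻¹` absorb a number of steps linear in `d`. -/
theorem rate_mul_dim_le (hS : S.PosDef) : rate S * (2 * d) ≤ 1 := by
  have h1 : ∑ i : Fin d, ∫ v : USphere d,
      inner ℝ (EuclideanSpace.basisFun (Fin d) ℝ i) (‖invSqrt S v‖⁻¹ • invSqrt S v) ^ 2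
        ∂(uniformSphere d) = 1 := by
    rw [← integral_finsetSum _ fun i _ => integrable_inner_dir_sq hS _]
    simp_rw [(EuclideanSpace.basisFun (Fin d) ℝ).sum_sq_inner_right, norm_dir hS]
    simp
  have h2 : ∑ i : Fin d, 2 * rate S ≤ 1 := by
    rw [← h1]
    refine Finset.sum_le_sum fun i _ => ?_
    exact two_mul_rate_le S ⟨EuclideanSpace.basisFun (Fin d) ℝ i, by
      rw [mem_sphere_zero_iff_norm]; exact (EuclideanSpace.basisFun (Fin d) ℝ).norm_eq_one i⟩
  rw [Finset.sum_const, Finset.card_univ, Fintype.card_fin, nsmul_eq_mul] at h2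
  linarith

theorem integral_inner_sq_uniformSphere {a : Space d} (ha : ‖a‖ = 1) :
    ∫ v : USphere d, inner ℝ a (v : Space d) ^ 2 ∂(uniformSphere d) = (d : ℝ)⁻¹ := by
  rw [integral_eq_lintegral_of_nonneg_ae (ae_of_all _ fun v => sq_nonneg _)
    (Measurable.aestronglyMeasurable (by fun_prop)), lintegral_inner_sq_uniformSphere d ha]
  simp

theorem maxEig_pos (hS : S.PosDef) : 0 < maxEig S := (minEig_pos hS).trans_le (minEig_le_maxEig hS)

/-- Since `|J v|² ≤ M`, the integrand is at least `⟨J ζ, v⟩² / M`, whose mean `|J ζ|² / (M d)` is at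
least `m / (M d)` uniformly in `ζ`. -/
theorem rate_pos (hS : S.PosDef) : 0 < rate S := by
  have hd : (0 : ℝ) < d := by exact_mod_cast Nat.pos_of_neZero d
  have hm := minEig_pos hS
  have hM := maxEig_pos hS
  have : Nonempty (USphere d) := by
    have : Nonempty (Fin d) := ⟨0⟩
    exact (NormedSpace.sphere_nonempty.2 zero_le_one).to_subtype
  have key : ∀ ζ : USphere d, minEig S / (maxEig S * d) ≤ ∫ v : USphere d,
      (inner ℝ (ζ : Space d) (‖invSqrt S v‖⁻¹ • invSqrt S v)) ^ 2 ∂(uniformSphere d) := by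
    intro ζ
    have hζ : ‖(ζ : Space d)‖ = 1 := mem_sphere_zero_iff_norm.1 ζ.2
    have hJζ := invSqrt_ne_zero hS (sphere_ne_zero ζ)
    have hn : ‖invSqrt S ζ‖ ≠ 0 := norm_ne_zero_iff.2 hJζ
    set a := ‖invSqrt S ζ‖⁻¹ • invSqrt S ζ with ha
    have ha1 : ‖a‖ = 1 := norm_dir hS ζ
    have hpt : ∀ v : USphere d, ‖invSqrt S ζ‖ ^ 2 / maxEig S * inner ℝ a (v : Space d) ^ 2 ≤
        (inner ℝ (ζ : Space d) (‖invSqrt S v‖⁻¹ • invSqrt S v)) ^ 2 := by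
      intro v
      have hv : ‖(v : Space d)‖ = 1 := mem_sphere_zero_iff_norm.1 v.2
      have hJv : 0 < ‖invSqrt S v‖ := norm_pos_iff.2 (invSqrt_ne_zero hS (sphere_ne_zero v))
      have hle := norm_invSqrt_sq_le hS (v : Space d)
      rw [hv, one_pow, mul_one] at hle
      have e1 : inner ℝ a (v : Space d) = ‖invSqrt S ζ‖⁻¹ * inner ℝ (ζ : Space d) (invSqrt S v) := by
        rw [ha, inner_smul_left, inner_invSqrt_right]
        simp
      rw [e1, inner_smul_right, mul_pow, mul_pow]
      calc _ = (maxEig S)⁻¹ * inner ℝ (ζ : Space d) (invSqrt S v) ^ 2 := by field_simp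
        _ ≤ _ := by
          rw [inv_pow]
          gcongr
    have hint : Integrable (fun v : USphere d => inner ℝ a (v : Space d) ^ 2)
        (uniformSphere d) := by
      refine Integrable.of_bound (Measurable.aestronglyMeasurable (by fun_prop)) 1
        (ae_of_all _ fun v => ?_)
      have h := abs_real_inner_le_norm a (v : Space d)
      rw [ha1, mem_sphere_zero_iff_norm.1 v.2, mul_one] at h
      rw [Real.norm_of_nonneg (sq_nonneg _)]
      exact (sq_le_one_iff_abs_le_one _).2 h
    have h2 := integral_mono (hint.const_mul (‖invSqrt S ζ‖ ^ 2 / maxEig S))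
      (integrable_inner_dir_sq hS (ζ : Space d)) hpt
    rw [integral_const_mul, integral_inner_sq_uniformSphere ha1] at h2
    refine le_trans ?_ h2
    have hle := le_norm_invSqrt_sq hS (ζ : Space d)
    rw [hζ, one_pow, mul_one] at hle
    rw [← div_div, div_eq_mul_inv _ (d : ℝ)]
    gcongr
  have h := le_ciInf key
  have hpos : 0 < minEig S / (maxEig S * d) := by positivity
  rw [rate]
  linarith

/-- By Pythagoras the step removes exactly the squared component along the random direction, whose
mean is at least `2ρ` times the squared norm. -/
theorem lintegral_norm_sq_move_sub_le (hS : S.PosDef) (x y : Space d) :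
    ∫⁻ ω, ENNReal.ofReal (‖invSqrt S (move (invSqrt S) x ω.1 ω.2 - move (invSqrt S) y ω.1 ω.2)‖ ^ 2)
      ∂(innovation d) ≤
    ENNReal.ofReal (1 - 2 * rate S) * ENNReal.ofReal (‖invSqrt S (x - y)‖ ^ 2) := by
  set w := invSqrt S (x - y) with hw
  have hpt : ∀ ω : USphere d × ℝ,
      ‖invSqrt S (move (invSqrt S) x ω.1 ω.2 - move (invSqrt S) y ω.1 ω.2)‖ ^ 2 =
      ‖w‖ ^ 2 - inner ℝ w (‖invSqrt S ω.1‖⁻¹ • invSqrt S ω.1) ^ 2 := by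
    intro ω
    rw [invSqrt_move_sub, ← hw]
    have hu := norm_dir hS ω.1
    rw [norm_sub_sq_real, inner_smul_right, norm_smul, hu, mul_one, Real.norm_eq_abs, sq_abs]
    ring
  have hm := measurable_dir S
  simp_rw [hpt]
  rw [innovation, lintegral_prod _ (by fun_prop)]
  simp only [lintegral_const, measure_univ, mul_one]
  have hint : Integrable (fun v : USphere d =>
      ‖w‖ ^ 2 - inner ℝ w (‖invSqrt S v‖⁻¹ • invSqrt S v) ^ 2) (uniformSphere d) :=
    (integrable_const _).sub (integrable_inner_dir_sq hS w)
  rw [← ofReal_integral_eq_lintegral_ofReal hint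
    (ae_of_all _ fun v => sub_nonneg.2 (inner_dir_sq_le hS w v)),
    integral_sub (integrable_const _) (integrable_inner_dir_sq hS w),
    ← ENNReal.ofReal_mul' (sq_nonneg _)]
  refine ENNReal.ofReal_le_ofReal ?_
  have := two_mul_rate_mul_norm_sq_le S w
  simp only [integral_const, probReal_univ, one_smul]
  linarith

/-- Transport cost of a coupling for the metric `|S^{-1/2} (x - y)|`. -/
def cost (S : Matrix (Fin d) (Fin d) ℝ) (q : Measure (Space d × Space d)) : ℝ≥0∞ :=
  ∫⁻ z, ENNReal.ofReal (‖invSqrt S (z.1 - z.2)‖ ^ 2) ∂q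

/-- The synchronous coupling of one Hit-and-Run step contracts the transport cost. -/
theorem exists_coupling_step (hS : S.PosDef) (q : Measure (Space d × Space d)) [IsProbabilityMeasure q] :
    ∃ q' : Measure (Space d × Space d), IsProbabilityMeasure q' ∧
      q'.fst = q.fst.bind (hitAndRun (gaussianDensity S) (measurable_gaussianDensity S)) ∧
      q'.snd = q.snd.bind (hitAndRun (gaussianDensity S) (measurable_gaussianDensity S)) ∧
      cost S q' ≤ ENNReal.ofReal (1 - 2 * rate S) * cost S q := by
  set J := invSqrt S
  have hm1 : Measurable (fun p : (Space d × Space d) × (USphere d × ℝ) =>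
      move J p.1.1 p.2.1 p.2.2) := by fun_prop
  have hm2 : Measurable (fun p : (Space d × Space d) × (USphere d × ℝ) =>
      move J p.1.2 p.2.1 p.2.2) := by fun_prop
  have hm := hm1.prodMk hm2
  refine ⟨(q.prod (innovation d)).map (fun p : (Space d × Space d) × (USphere d × ℝ) =>
    (move J p.1.1 p.2.1 p.2.2, move J p.1.2 p.2.1 p.2.2)),
    Measure.isProbabilityMeasure_map hm.aemeasurable, ?_, ?_, ?_⟩
  · rw [Measure.fst, Measure.map_map measurable_fst hm]
    change (q.prod (innovation d)).map (fun p : (Space d × Space d) × (USphere d × ℝ) =>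
      move J p.1.1 p.2.1 p.2.2) = _
    refine Measure.ext_of_lintegral _ fun f hf => ?_
    have hfm : Measurable (fun p : (Space d × Space d) × (USphere d × ℝ) =>
        f (move J p.1.1 p.2.1 p.2.2)) := hf.comp hm1
    rw [Measure.lintegral_bind (Kernel.aemeasurable _) hf.aemeasurable, lintegral_map hf hm1,
      lintegral_prod _ hfm.aemeasurable]
    simp_rw [lintegral_hitAndRun hS _ hf]
    rw [Measure.fst, lintegral_map _ measurable_fst]
    have : Measurable (fun p : Space d × (USphere d × ℝ) => f (move J p.1 p.2.1 p.2.2)) :=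
      hf.comp (by fun_prop)
    exact this.lintegral_prod_right'
  · rw [Measure.snd, Measure.map_map measurable_snd hm]
    change (q.prod (innovation d)).map (fun p : (Space d × Space d) × (USphere d × ℝ) =>
      move J p.1.2 p.2.1 p.2.2) = _
    refine Measure.ext_of_lintegral _ fun f hf => ?_
    have hfm : Measurable (fun p : (Space d × Space d) × (USphere d × ℝ) =>
        f (move J p.1.2 p.2.1 p.2.2)) := hf.comp hm2
    rw [Measure.lintegral_bind (Kernel.aemeasurable _) hf.aemeasurable, lintegral_map hf hm2,
      lintegral_prod _ hfm.aemeasurable]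
    simp_rw [lintegral_hitAndRun hS _ hf]
    rw [Measure.snd, lintegral_map _ measurable_snd]
    have : Measurable (fun p : Space d × (USphere d × ℝ) => f (move J p.1 p.2.1 p.2.2)) :=
      hf.comp (by fun_prop)
    exact this.lintegral_prod_right'
  · rw [cost, lintegral_map (by fun_prop) hm, lintegral_prod _ (by fun_prop), cost,
      ← lintegral_const_mul _ (by fun_prop)]
    exact lintegral_mono fun z => lintegral_norm_sq_move_sub_le hS z.1 z.2

theorem exists_coupling_lawAfter (hS : S.PosDef) (n : ℕ) (q : Measure (Space d × Space d))
    [IsProbabilityMeasure q] :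
    ∃ q' : Measure (Space d × Space d), IsProbabilityMeasure q' ∧
      q'.fst = lawAfter (hitAndRun (gaussianDensity S) (measurable_gaussianDensity S)) q.fst n ∧
      q'.snd = lawAfter (hitAndRun (gaussianDensity S) (measurable_gaussianDensity S)) q.snd n ∧
      cost S q' ≤ ENNReal.ofReal (1 - 2 * rate S) ^ n * cost S q := by
  induction n with
  | zero => exact ⟨q, inferInstance, rfl, rfl, by simp⟩
  | succ n ih =>
    obtain ⟨q', hq', h1, h2, h3⟩ := ih
    obtain ⟨q'', hq'', g1, g2, g3⟩ := exists_coupling_step hS q'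
    refine ⟨q'', hq'', ?_, ?_, ?_⟩
    · rw [g1, h1, lawAfter, lawAfter, Function.iterate_succ_apply']
    · rw [g2, h2, lawAfter, lawAfter, Function.iterate_succ_apply']
    · calc cost S q'' ≤ _ := g3
        _ ≤ ENNReal.ofReal (1 - 2 * rate S) * (ENNReal.ofReal (1 - 2 * rate S) ^ n * cost S q) := by
          gcongr
        _ = _ := by rw [pow_succ]; ring

end Contraction

/-! ### Cost of representing a unit vector by random directions. -/

section Control

variable {d k : ℕ}

/-- The least value of `∑ cᵢ²` over the representations `e = ∑ cᵢ vᵢ`, in dual form. -/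
def controlCost (e : Space d) (v : Fin k → Space d) : ℝ≥0∞ :=
  ⨆ ξ : Space d, ENNReal.ofReal (2 * inner ℝ ξ e - ∑ i, inner ℝ ξ (v i) ^ 2)

/-- The dual form is a supremum of continuous functions of `v`, hence lower semicontinuous; no
measurable choice of coefficients is needed. -/
theorem measurable_controlCost (e : Space d) :
    Measurable (fun v : Fin k → Space d => controlCost e v) := by
  refine LowerSemicontinuous.measurable (lowerSemicontinuous_iSup fun ξ => ?_)
  exact (ENNReal.continuous_ofReal.comp (by fun_prop)).lowerSemicontinuous

theorem controlCost_le {e : Space d} {v : Fin k → Space d} {c : Fin k → ℝ}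
    (h : ∑ i, c i • v i = e) : controlCost e v ≤ ENNReal.ofReal (∑ i, c i ^ 2) := by
  refine iSup_le fun ξ => ENNReal.ofReal_le_ofReal ?_
  rw [← h, inner_sum, Finset.mul_sum, ← Finset.sum_sub_distrib]
  refine Finset.sum_le_sum fun i _ => ?_
  rw [inner_smul_right]
  nlinarith [sq_nonneg (inner ℝ ξ (v i) - c i)]

/-- Strong duality. Finiteness of the supremum forces `e` into the range of the frame operator `A ξ
= ∑ ⟨vᵢ, ξ⟩ vᵢ`; a solution of `A ξ = e` gives the coefficients `⟨vᵢ, ξ⟩`, and the dual value at `ξ`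
is their sum of squares. -/
theorem exists_control_of_controlCost_ne_top {e : Space d} {v : Fin k → Space d}
    (h : controlCost e v ≠ ∞) :
    ∃ c : Fin k → ℝ, ∑ i, c i • v i = e ∧ ENNReal.ofReal (∑ i, c i ^ 2) ≤ controlCost e v := by
  set A : Space d →ₗ[ℝ] Space d := ∑ i, (innerₛₗ ℝ (v i)).smulRight (v i) with hA
  have hAapp : ∀ ξ, A ξ = ∑ i, inner ℝ (v i) ξ • v i := by
    intro ξ
    simp [hA, LinearMap.sum_apply]
  have hq : ∀ ξ η, inner ℝ (A ξ) η = ∑ i, inner ℝ (v i) ξ * inner ℝ (v i) η := by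
    intro ξ η
    rw [hAapp, sum_inner]
    exact Finset.sum_congr rfl fun i _ => by rw [inner_smul_left]; simp
  have hsymm : A.IsSymmetric := by
    intro ξ η
    rw [hq, real_inner_comm, hq]
    exact Finset.sum_congr rfl fun i _ => mul_comm _ _
  have hle : ∀ ξ, 2 * inner ℝ ξ e - ∑ i, inner ℝ ξ (v i) ^ 2 ≤ (controlCost e v).toReal := by
    intro ξ
    have := le_iSup (fun ξ : Space d =>
      ENNReal.ofReal (2 * inner ℝ ξ e - ∑ i, inner ℝ ξ (v i) ^ 2)) ξ
    exact (ENNReal.ofReal_le_iff_le_toReal h).1 this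
  have hmem : e ∈ A.range := by
    rw [← Submodule.orthogonal_orthogonal A.range, hsymm.orthogonal_range,
      Submodule.mem_orthogonal]
    intro ξ hξ
    have h0 : ∑ i, inner ℝ (v i) ξ * inner ℝ (v i) ξ = 0 := by
      rw [← hq, LinearMap.mem_ker.1 hξ, inner_zero_left]
    have h1 : ∀ i, inner ℝ (v i) ξ = 0 := by
      intro i
      have := (Finset.sum_eq_zero_iff_of_nonneg fun i _ => mul_self_nonneg _).1 h0 i
        (Finset.mem_univ i)
      exact mul_self_eq_zero.1 this
    by_contra hne
    set B := (controlCost e v).toReal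
    -- On the kernel of `A` the quadratic term vanishes, so this multiple of `ξ` has dual value `B +
    -- 1`, exceeding the bound `B`.
    have h2 := hle (((B + 1) / (2 * inner ℝ ξ e)) • ξ)
    have h3 : ∀ i, inner ℝ (((B + 1) / (2 * inner ℝ ξ e)) • ξ) (v i) = 0 := by
      intro i
      rw [inner_smul_left, real_inner_comm (v i), h1, mul_zero]
    simp only [h3, inner_smul_left] at h2
    simp at h2
    field_simp at h2
    linarith
  obtain ⟨ξ, hξ⟩ := hmem
  refine ⟨fun i => inner ℝ (v i) ξ, by rw [← hAapp, hξ], ?_⟩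
  refine ENNReal.ofReal_le_of_le_toReal (le_trans (le_of_eq ?_) (hle ξ))
  have h1 : inner ℝ ξ e = ∑ i, inner ℝ (v i) ξ * inner ℝ (v i) ξ := by
    rw [← hq, hξ, real_inner_comm]
  rw [h1, Finset.mul_sum, ← Finset.sum_sub_distrib]
  refine Finset.sum_congr rfl fun i _ => ?_
  rw [real_inner_comm (v i)]
  ring

/-- Averaging over independent radii increases the control cost, up to normalization. -/
theorem controlCost_le_lintegral [NeZero d] {Λ : Measure ℝ} [IsProbabilityMeasure Λ]
    (hΛ : ∫⁻ r, ENNReal.ofReal (r ^ 2) ∂Λ = d) (e : Space d) (v : Fin k → Space d) :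
    controlCost e v ≤
      d * ∫⁻ r, controlCost e (fun i => r i • v i) ∂(Measure.pi fun _ : Fin k => Λ) := by
  have hd : (0 : ℝ) < d := by exact_mod_cast Nat.pos_of_neZero d
  refine iSup_le fun ξ => ?_
  -- Testing with `ξ / d` balances the second moment `d` of the radii: the mean dual value there is
  -- `1 / d` times the original value at `ξ`.
  set a : ℝ := 2 * inner ℝ ((d : ℝ)⁻¹ • ξ) e with ha
  set Y : (Fin k → ℝ) → ℝ := fun r => ∑ i, inner ℝ ((d : ℝ)⁻¹ • ξ) (r i • v i) ^ 2 with hY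
  have hYm : Measurable Y := by fun_prop
  have hYnn : ∀ r, 0 ≤ Y r := fun r => Finset.sum_nonneg fun i _ => sq_nonneg _
  have hYint : ∫⁻ r, ENNReal.ofReal (Y r) ∂(Measure.pi fun _ : Fin k => Λ) =
      ENNReal.ofReal ((d : ℝ)⁻¹ * ∑ i, inner ℝ ξ (v i) ^ 2) := by
    simp only [hY]
    simp_rw [ENNReal.ofReal_sum_of_nonneg fun i _ => sq_nonneg (_ : ℝ)]
    rw [lintegral_finsetSum _ (fun i _ => by fun_prop)]
    have h1 : ∀ i : Fin k, ∫⁻ r : Fin k → ℝ,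
        ENNReal.ofReal (inner ℝ ((d : ℝ)⁻¹ • ξ) (r i • v i) ^ 2)
          ∂(Measure.pi fun _ : Fin k => Λ) =
        ENNReal.ofReal ((d : ℝ)⁻¹ * inner ℝ ξ (v i) ^ 2) := by
      intro i
      have h2 := (measurePreserving_eval (fun _ : Fin k => Λ) i).lintegral_comp
        (f := fun r : ℝ => ENNReal.ofReal (r ^ 2) *
          ENNReal.ofReal (inner ℝ ((d : ℝ)⁻¹ • ξ) (v i) ^ 2)) (by fun_prop)
      rw [lintegral_mul_const (μ := Λ) _ (by fun_prop), hΛ] at h2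
      simp_rw [inner_smul_right, mul_pow, ENNReal.ofReal_mul (sq_nonneg (_ : ℝ))]
      simp only [Function.eval] at h2
      rw [h2, ← ENNReal.ofReal_natCast, ← ENNReal.ofReal_mul (by positivity), inner_smul_left]
      congr 1
      simp
      field_simp
    simp_rw [h1]
    rw [Finset.mul_sum, ENNReal.ofReal_sum_of_nonneg fun i _ => by positivity]
  have hmain : ENNReal.ofReal a ≤ ∫⁻ r, ENNReal.ofReal (a - Y r) ∂(Measure.pi fun _ : Fin k => Λ) +
      ENNReal.ofReal ((d : ℝ)⁻¹ * ∑ i, inner ℝ ξ (v i) ^ 2) := by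
    rw [← hYint, ← lintegral_add_right _ (by fun_prop)]
    calc ENNReal.ofReal a = ∫⁻ _, ENNReal.ofReal a ∂(Measure.pi fun _ : Fin k => Λ) := by simp
      _ ≤ _ := by
        refine lintegral_mono fun r => ?_
        refine le_trans (le_of_eq ?_) ENNReal.ofReal_add_le
        congr 1
        ring
  have hsub : ENNReal.ofReal (a - (d : ℝ)⁻¹ * ∑ i, inner ℝ ξ (v i) ^ 2) ≤
      ∫⁻ r, controlCost e (fun i => r i • v i) ∂(Measure.pi fun _ : Fin k => Λ) := by
    rw [ENNReal.ofReal_sub _ (by positivity)]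
    refine (tsub_le_iff_right.2 hmain).trans (lintegral_mono fun r => ?_)
    exact le_iSup (fun ξ : Space d =>
      ENNReal.ofReal (2 * inner ℝ ξ e - ∑ i, inner ℝ ξ (r i • v i) ^ 2)) ((d : ℝ)⁻¹ • ξ)
  refine le_trans (le_of_eq ?_) (mul_le_mul_right hsub _)
  rw [← ENNReal.ofReal_natCast, ← ENNReal.ofReal_mul (by positivity)]
  congr 1
  rw [ha, inner_smul_left]
  simp
  field_simp

/-- Rank-nullity. Coefficients in the span of `b` cancel the frozen parts `p i` of the directions.
-/
theorem exists_orthonormal_annihilator (p : Fin k → Space d) {r : ℕ} (hr : r + d ≤ k) :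
    ∃ b : Fin r → EuclideanSpace ℝ (Fin k), Orthonormal ℝ b ∧ ∀ j, ∑ i, b j i • p i = 0 := by
  let T : EuclideanSpace ℝ (Fin k) →ₗ[ℝ] Space d :=
    { toFun := fun c => ∑ i, c i • p i
      map_add' := fun x y => by simp [add_smul, Finset.sum_add_distrib]
      map_smul' := fun a x => by simp [Finset.smul_sum, smul_smul] }
  have h1 := T.finrank_range_add_finrank_ker
  have h2 : Module.finrank ℝ T.range ≤ d := by
    simpa using Submodule.finrank_le T.range
  have h3 : r ≤ Module.finrank ℝ T.ker := by
    rw [finrank_euclideanSpace, Fintype.card_fin] at h1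
    omega
  have hb := (stdOrthonormalBasis ℝ T.ker).orthonormal
  refine ⟨fun j => (stdOrthonormalBasis ℝ T.ker (Fin.castLE h3 j) : EuclideanSpace ℝ (Fin k)),
    ?_, fun j => ?_⟩
  · exact (hb.comp_linearIsometry T.ker.subtypeₗᵢ).comp _ (Fin.castLE_injective h3)
  · exact LinearMap.mem_ker.1 (stdOrthonormalBasis ℝ T.ker (Fin.castLE h3 j)).2

/-- Of the `3 d + 2` coefficients, `d` dimensions are spent on cancelling the parts off `e`. The
projection `t` of `s` on the remaining `2 d + 2` is standard Gaussian, and the cost is at most `1 /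
|t|²`, of mean at most `1 / (2 d)`. -/
theorem lintegral_controlCost_resample_le [NeZero d] (hk : k = 3 * d + 2) {e : Space d}
    (p : Fin k → Space d) :
    ∫⁻ s, controlCost e (fun i => p i + (s i - inner ℝ (p i) e) • e)
      ∂(Measure.pi fun _ : Fin k => gaussianReal 0 1) ≤ ENNReal.ofReal ((2 * d : ℝ)⁻¹) := by
  obtain ⟨b, hb, hbp⟩ := exists_orthonormal_annihilator
    (fun i => p i - inner ℝ (p i) e • e) (r := 2 * d + 2) (by omega)
  refine le_trans (lintegral_mono (g := fun s : Fin k → ℝ => (fun t : Fin (2 * d + 2) → ℝ =>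
    (ENNReal.ofReal (∑ j, t j ^ 2))⁻¹) (fun j => inner ℝ (b j) (WithLp.toLp 2 s)))
      fun s => ?_) ?_
  · set t : Fin (2 * d + 2) → ℝ := fun j => inner ℝ (b j) (WithLp.toLp 2 s) with ht
    set T := ∑ j, t j ^ 2 with hT
    change _ ≤ (ENNReal.ofReal T)⁻¹
    have hTnn : 0 ≤ T := Finset.sum_nonneg fun j _ => sq_nonneg _
    rcases hTnn.eq_or_lt with h0 | hpos
    · rw [← h0]
      simp
    -- The shortest vector in the span of `b` with `⟨c, s⟩ = 1`.
    set c : EuclideanSpace ℝ (Fin k) := T⁻¹ • ∑ j, t j • b j with hc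
    have hcs : ∑ i, c i * s i = 1 := by
      have h1 : inner ℝ c (WithLp.toLp 2 s) = ∑ i, c i * s i := by
        rw [PiLp.inner_apply]
        exact Finset.sum_congr rfl fun i _ => by simp [mul_comm]
      rw [← h1, hc, inner_smul_left, sum_inner]
      have h2 : ∀ j, inner ℝ (t j • b j) (WithLp.toLp 2 s) = t j ^ 2 := by
        intro j
        rw [inner_smul_left]
        simp [ht, pow_two]
      simp_rw [h2]
      simp [← hT, hpos.ne']
    have hcc : ∑ i, c i ^ 2 = T⁻¹ := by
      rw [← EuclideanSpace.real_norm_sq_eq, hc, norm_smul, mul_pow]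
      have h2 : ‖∑ j, t j • b j‖ ^ 2 = T := by
        rw [← real_inner_self_eq_norm_sq, hb.inner_sum]
        simp [hT, pow_two]
      rw [h2, Real.norm_eq_abs, sq_abs]
      field_simp
    have hcp : ∑ i, c i • (p i - inner ℝ (p i) e • e) = 0 := by
      have h1 : ∀ i, c i • (p i - inner ℝ (p i) e • e) =
          T⁻¹ • ∑ j, t j • (b j i • (p i - inner ℝ (p i) e • e)) := by
        intro i
        simp only [smul_smul, ← Finset.sum_smul]
        congr 1
        simp [hc, Finset.sum_apply]
      simp_rw [h1]
      rw [← Finset.smul_sum, Finset.sum_comm]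
      simp_rw [← Finset.smul_sum, hbp]
      simp
    have hrep : ∑ i, c i • (p i + (s i - inner ℝ (p i) e) • e) = e := by
      have h1 : ∀ i, c i • (p i + (s i - inner ℝ (p i) e) • e) =
          c i • (p i - inner ℝ (p i) e • e) + (c i * s i) • e := fun i => by module
      simp_rw [h1]
      rw [Finset.sum_add_distrib, hcp, ← Finset.sum_smul, hcs, zero_add, one_smul]
    refine (controlCost_le hrep).trans_eq ?_
    rw [hcc, ENNReal.ofReal_inv_of_pos hpos]
  · have hm : Measurable (fun t : Fin (2 * d + 2) → ℝ => (ENNReal.ofReal (∑ j, t j ^ 2))⁻¹) := by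
      fun_prop
    rw [← lintegral_map hm (by fun_prop), map_inner_orthonormal hb]
    exact lintegral_inv_sum_sq_le (Nat.pos_of_neZero d)

/-- Resampling every vector along `e` preserves the law, and the conditional bound holds for all
frozen parts. -/
theorem lintegral_controlCost_stdGaussian_le [NeZero d] (hk : k = 3 * d + 2) {e : Space d}
    (he : ‖e‖ = 1) :
    ∫⁻ g, controlCost e g ∂(Measure.pi fun _ : Fin k => stdGaussian (Space d)) ≤
      ENNReal.ofReal ((2 * d : ℝ)⁻¹) := by
  have hm : Measurable (fun p : Space d × ℝ => p.1 + (p.2 - inner ℝ p.1 e) • e) := by fun_prop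
  have h1 := Measure.pi_map_pi (μ := fun _ : Fin k => (stdGaussian (Space d)).prod (gaussianReal 0 1))
    (f := fun _ (p : Space d × ℝ) => p.1 + (p.2 - inner ℝ p.1 e) • e)
    (hμ := fun _ => by rw [stdGaussian_map_resample he]; infer_instance)
    (fun _ => hm.aemeasurable)
  simp_rw [stdGaussian_map_resample he] at h1
  have hm2 : Measurable (fun q : (Fin k → Space d) × (Fin k → ℝ) =>
      controlCost e (fun i => q.1 i + (q.2 i - inner ℝ (q.1 i) e) • e)) :=
    (measurable_controlCost e).comp (by fun_prop)
  have h2 := (measurePreserving_arrowProdEquivProdArrow (Space d) ℝ (Fin k)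
    (fun _ => stdGaussian (Space d)) (fun _ => gaussianReal 0 1)).lintegral_comp hm2
  rw [lintegral_prod _ hm2.aemeasurable] at h2
  rw [← h1, lintegral_map (measurable_controlCost e) (by fun_prop)]
  refine (Eq.trans_le h2 ?_)
  calc _ ≤ ∫⁻ _, ENNReal.ofReal ((2 * d : ℝ)⁻¹)
        ∂(Measure.pi fun _ : Fin k => stdGaussian (Space d)) :=
        lintegral_mono fun p => lintegral_controlCost_resample_le hk p
    _ = _ := by simp

/-- Inserting independent Gaussian radii costs a factor `d`, which the Gaussian bound `1 / (2 d)`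
pays for. -/
theorem lintegral_controlCost_uniformSphere_le [NeZero d] (hk : k = 3 * d + 2) {e : Space d}
    (he : ‖e‖ = 1) :
    ∫⁻ v : Fin k → USphere d, controlCost e (fun i => (v i : Space d))
      ∂(Measure.pi fun _ => uniformSphere d) ≤ 1 := by
  obtain ⟨Λ, hΛ, hmap, hsq⟩ := exists_polar_stdGaussian d
  have hm : Measurable (fun p : ℝ × USphere d => p.1 • (p.2 : Space d)) := by fun_prop
  have h1 := Measure.pi_map_pi (μ := fun _ : Fin k => Λ.prod (uniformSphere d))
    (f := fun _ (p : ℝ × USphere d) => p.1 • (p.2 : Space d))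
    (hμ := fun _ => by rw [hmap]; infer_instance) (fun _ => hm.aemeasurable)
  simp_rw [hmap] at h1
  have hm2 : Measurable (fun q : (Fin k → ℝ) × (Fin k → USphere d) =>
      controlCost e (fun i => q.1 i • (q.2 i : Space d))) :=
    (measurable_controlCost e).comp (by fun_prop)
  have h2 := (measurePreserving_arrowProdEquivProdArrow ℝ (USphere d) (Fin k)
    (fun _ => Λ) (fun _ => uniformSphere d)).lintegral_comp hm2
  rw [lintegral_prod_symm _ hm2.aemeasurable] at h2
  have h3 := lintegral_controlCost_stdGaussian_le hk he
  rw [← h1, lintegral_map (measurable_controlCost e) (by fun_prop)] at h3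
  have hd : (0 : ℝ) < d := by exact_mod_cast Nat.pos_of_neZero d
  calc _ ≤ ∫⁻ v : Fin k → USphere d, d * ∫⁻ r, controlCost e (fun i => r i • (v i : Space d))
        ∂(Measure.pi fun _ : Fin k => Λ) ∂(Measure.pi fun _ => uniformSphere d) :=
        lintegral_mono fun v => controlCost_le_lintegral hsq e _
    _ = d * ∫⁻ v : Fin k → USphere d, ∫⁻ r, controlCost e (fun i => r i • (v i : Space d))
        ∂(Measure.pi fun _ : Fin k => Λ) ∂(Measure.pi fun _ => uniformSphere d) :=
        lintegral_const_mul _ hm2.lintegral_prod_left'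
    _ ≤ d * ENNReal.ofReal ((2 * d : ℝ)⁻¹) := by
        gcongr
        exact h2.symm.trans_le h3
    _ ≤ 1 := by
        rw [← ENNReal.ofReal_natCast, ← ENNReal.ofReal_mul (by positivity),
          ENNReal.ofReal_le_one]
        rw [mul_inv]
        field_simp
        norm_num

end Control

/-! ### From transport distance to total variation in `3 d + 2` steps. -/

section Smoothing

variable {d : ℕ} {S : Matrix (Fin d) (Fin d) ℝ}

/-- Given directions `vᵢ` and coefficients `cᵢ`, shifting the innovations by a suitable constant
vector moves the trajectory started from `x` onto the one started from `y = x + ∑ cᵢ vᵢ`. -/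
theorem exists_shift_trajectory (hS : S.PosDef) {k : ℕ} (v : Fin k → USphere d) (c : Fin k → ℝ) :
    ∃ h : Fin k → ℝ, (∀ i, |h i| ≤ ∑ j, |c j| * ‖invSqrt S (v j)‖) ∧
      ∀ x y : Space d, x - y + ∑ i, c i • (v i : Space d) = 0 → ∀ z : Fin k → ℝ,
        trajectory (invSqrt S) k x (fun i => (v i, z i + h i)) =
          trajectory (invSqrt S) k y (fun i => (v i, z i)) := by
  induction k with
  | zero =>
    refine ⟨fun _ => 0, fun i => i.elim0, fun x y hxy z => ?_⟩
    simp only [Finset.univ_eq_empty, Finset.sum_empty, add_zero] at hxy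
    exact sub_eq_zero.1 hxy
  | succ k ih =>
    obtain ⟨h, hle, hmove⟩ := ih (fun i => v i.succ) (fun i => c i.succ)
    set J := invSqrt S
    set u := ‖J (v 0)‖⁻¹ • J (v 0) with hu_def
    have hu : ‖u‖ = 1 := norm_dir hS (v 0)
    have hJ : 0 < ‖J (v 0)‖ := norm_pos_iff.2 (invSqrt_ne_zero hS (sphere_ne_zero (v 0)))
    -- Chosen so that the first step changes `x - y` by exactly `c 0 • v 0`, leaving the later
    -- directions to cancel the rest. The step erases the old coordinate along `u`, so `c 0` does
    -- not enter.
    set h0 : ℝ := -∑ i : Fin k, c i.succ * inner ℝ (J (v i.succ)) u with hh0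
    refine ⟨Fin.cons h0 h, fun i => ?_, fun x y hxy z => ?_⟩
    · have hstep : ∑ j : Fin k, |c j.succ| * ‖J (v j.succ)‖ ≤ ∑ j, |c j| * ‖J (v j)‖ := by
        rw [Fin.sum_univ_succ (fun j : Fin (k + 1) => |c j| * ‖J (v j)‖)]
        have : 0 ≤ |c 0| * ‖J (v 0)‖ := by positivity
        linarith
      refine Fin.cases ?_ (fun i => ?_) i
      · refine le_trans ?_ hstep
        rw [Fin.cons_zero, hh0, abs_neg]
        refine (Finset.abs_sum_le_sum_abs _ _).trans (Finset.sum_le_sum fun j _ => ?_)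
        rw [abs_mul]
        have := abs_real_inner_le_norm (J (v j.succ)) u
        rw [hu, mul_one] at this
        gcongr
      · rw [Fin.cons_succ]
        exact (hle i).trans hstep
    · simp only [trajectory, Fin.cons_zero, Fin.cons_succ]
      refine hmove _ _ ?_ (fun i => z i.succ)
      rw [Fin.sum_univ_succ] at hxy
      have hw : x - y = -(c 0 • (v 0 : Space d) + ∑ i : Fin k, c i.succ • (v i.succ : Space d)) :=
        eq_neg_of_add_eq_zero_left hxy
      have hin : inner ℝ (J x) u - inner ℝ (J y) u = h0 - c 0 * ‖J (v 0)‖ := by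
        have h0u : inner ℝ (J (v 0)) u = ‖J (v 0)‖ := by
          rw [hu_def, inner_smul_right, real_inner_self_eq_norm_sq]
          field_simp
        rw [← inner_sub_left, ← map_sub, hw, map_neg, map_add, map_smul, map_sum, inner_neg_left,
          inner_add_left, inner_smul_left, sum_inner, h0u, hh0]
        simp only [map_smul, inner_smul_left, RCLike.conj_to_real]
        ring
      have hcoef : (z 0 + h0 - inner ℝ (J x) u) * ‖J (v 0)‖⁻¹ -
          (z 0 - inner ℝ (J y) u) * ‖J (v 0)‖⁻¹ = c 0 := by
        have : z 0 + h0 - inner ℝ (J x) u - (z 0 - inner ℝ (J y) u) = c 0 * ‖J (v 0)‖ := by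
          linarith
        rw [← sub_mul, this, mul_assoc, mul_inv_cancel₀ hJ.ne', mul_one]
      have hdiff : move J x (v 0) (z 0 + h0) - move J y (v 0) (z 0) =
          x - y + c 0 • (v 0 : Space d) := by
        rw [← hcoef, move, move, ← hu_def]
        module
      rw [hdiff, ← hxy]
      abel

theorem measurable_trajectory_right (J : Space d →L[ℝ] Space d) (k : ℕ) (x : Space d) :
    Measurable (fun q : (Fin k → USphere d) × (Fin k → ℝ) =>
      trajectory J k x (fun i => (q.1 i, q.2 i))) := by
  have h : Measurable (fun q : (Fin k → USphere d) × (Fin k → ℝ) =>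
      ((x, fun i => (q.1 i, q.2 i)) : Space d × (Fin k → USphere d × ℝ))) := by fun_prop
  exact (measurable_trajectory J k).comp h

/-- With directions fixed, the final state depends on the Gaussian innovations alone, so changing
the starting point amounts to a shift of a Gaussian vector. -/
theorem pi_trajectory_le [NeZero d] (hS : S.PosDef) {k : ℕ} (hk : 0 < k) {x y e : Space d} (r : ℝ)
    (hr : y - x = r • e) (v : Fin k → USphere d) {A : Set (Space d)} (hA : MeasurableSet A) :
    Measure.pi (fun _ : Fin k => gaussianReal 0 1)
      {z | trajectory (invSqrt S) k x (fun i => (v i, z i)) ∈ A} ≤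
    Measure.pi (fun _ : Fin k => gaussianReal 0 1)
      {z | trajectory (invSqrt S) k y (fun i => (v i, z i)) ∈ A} +
    ENNReal.ofReal (k * √(maxEig S) * |r|) * (1 + controlCost e (fun i => (v i : Space d))) := by
  have hM := maxEig_pos hS
  -- Separated because `0 * ∞ = 0`: an infinite control cost makes the bound trivial only when `r ≠
  -- 0`.
  rcases eq_or_ne r 0 with rfl | hr0
  · rw [zero_smul, sub_eq_zero] at hr
    rw [hr]
    exact le_self_add
  rcases eq_or_ne (controlCost e (fun i => (v i : Space d))) ∞ with htop | htop
  · have hk' : (0 : ℝ) < k := by exact_mod_cast hk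
    have hpos : 0 < k * √(maxEig S) * |r| := by
      have := abs_pos.2 hr0
      positivity
    rw [htop, add_top, ENNReal.mul_top (ENNReal.ofReal_pos.2 hpos).ne', add_top]
    exact le_top
  obtain ⟨c, hc, hcle⟩ := exists_control_of_controlCost_ne_top htop
  obtain ⟨h, hle, hmove⟩ := exists_shift_trajectory hS v (fun i => r * c i)
  have hxy : x - y + ∑ i, (r * c i) • (v i : Space d) = 0 := by
    simp_rw [mul_smul]
    rw [← Finset.smul_sum, hc, ← hr]
    abel
  have hm : ∀ x : Space d, MeasurableSet
      {z : Fin k → ℝ | trajectory (invSqrt S) k x (fun i => (v i, z i)) ∈ A} := fun x =>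
    ((measurable_trajectory_right (invSqrt S) k x).comp measurable_prodMk_left) hA
  refine (pi_gaussianReal_le_shift h (hm x)).trans (add_le_add (le_of_eq ?_) ?_)
  · congr 1
    ext z
    simp only [Set.mem_preimage, Set.mem_ofPred_eq, Pi.add_apply]
    rw [hmove x y hxy z]
  · have hC : ∑ i, c i ^ 2 ≤ (controlCost e (fun i => (v i : Space d))).toReal :=
      (ENNReal.ofReal_le_iff_le_toReal htop).1 hcle
    have hJv : ∀ j, ‖invSqrt S (v j)‖ ≤ √(maxEig S) := by
      intro j
      refine Real.le_sqrt_of_sq_le ?_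
      have := norm_invSqrt_sq_le hS (v j : Space d)
      rwa [mem_sphere_zero_iff_norm.1 (v j).2, one_pow, mul_one] at this
    have hsumc : (∑ j, |c j|) ^ 2 ≤ k * ∑ j, c j ^ 2 := by
      have := sq_sum_le_card_mul_sum_sq (s := Finset.univ) (f := fun j => |c j|)
      simpa using this
    have hi : ∀ i, |h i| ≤ |r| * √(maxEig S) * ∑ j, |c j| := by
      intro i
      refine (hle i).trans ?_
      rw [Finset.mul_sum]
      refine Finset.sum_le_sum fun j _ => ?_
      rw [abs_mul, mul_assoc, mul_assoc, mul_comm (√(maxEig S))]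
      gcongr
      exact hJv j
    -- One factor `k` comes from Cauchy-Schwarz on `∑ |cⱼ|`, the other from summing over the `k`
    -- shifts.
    have hsq : ∑ i, h i ^ 2 ≤ (k * √(maxEig S) * |r|) ^ 2 * ∑ j, c j ^ 2 := by
      calc ∑ i, h i ^ 2 ≤ ∑ _i : Fin k, (|r| * √(maxEig S)) ^ 2 * (k * ∑ j, c j ^ 2) := by
            refine Finset.sum_le_sum fun i _ => ?_
            calc h i ^ 2 = |h i| ^ 2 := (sq_abs _).symm
              _ ≤ (|r| * √(maxEig S) * ∑ j, |c j|) ^ 2 := by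
                gcongr
                exact hi i
              _ = (|r| * √(maxEig S)) ^ 2 * (∑ j, |c j|) ^ 2 := by ring
              _ ≤ _ := by gcongr
        _ = _ := by
            rw [Finset.sum_const, Finset.card_univ, Fintype.card_fin, nsmul_eq_mul]
            ring
    have hroot : √(∑ i, h i ^ 2) ≤ k * √(maxEig S) * |r| *
        (1 + (controlCost e (fun i => (v i : Space d))).toReal) := by
      -- Makes the bound affine in `controlCost`, so that its mean alone suffices.
      have h1 : √(∑ j, c j ^ 2) ≤ 1 + ∑ j, c j ^ 2 := by
        have h0 : 0 ≤ ∑ j, c j ^ 2 := Finset.sum_nonneg fun j _ => sq_nonneg _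
        rw [Real.sqrt_le_left (by linarith)]
        nlinarith
      calc √(∑ i, h i ^ 2) ≤ √((k * √(maxEig S) * |r|) ^ 2 * ∑ j, c j ^ 2) :=
            Real.sqrt_le_sqrt hsq
        _ = k * √(maxEig S) * |r| * √(∑ j, c j ^ 2) := by
            rw [Real.sqrt_mul (sq_nonneg _), Real.sqrt_sq (by positivity)]
        _ ≤ _ := by gcongr; linarith
    refine (ENNReal.ofReal_le_ofReal hroot).trans_eq ?_
    rw [ENNReal.ofReal_mul (by positivity), ENNReal.ofReal_add zero_le_one ENNReal.toReal_nonneg,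
      ENNReal.ofReal_one, ENNReal.ofReal_toReal htop]

/-- Lipschitz regularity of the `k`-step transition probabilities. -/
theorem lintegral_trajectory_le [NeZero d] (hS : S.PosDef) {k : ℕ} (hk : k = 3 * d + 2)
    (x y : Space d) {A : Set (Space d)} (hA : MeasurableSet A) :
    ∫⁻ ω, A.indicator 1 (trajectory (invSqrt S) k x ω) ∂(Measure.pi fun _ => innovation d) ≤
    ∫⁻ ω, A.indicator 1 (trajectory (invSqrt S) k y ω) ∂(Measure.pi fun _ => innovation d) +
    ENNReal.ofReal (2 * k * √(maxEig S / minEig S)) *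
      ENNReal.ofReal ‖invSqrt S (x - y)‖ := by
  rcases eq_or_ne x y with rfl | hxy
  · exact le_self_add
  have hM := maxEig_pos hS
  have hmin := minEig_pos hS
  have key : ∀ x : Space d,
      ∫⁻ ω, A.indicator 1 (trajectory (invSqrt S) k x ω) ∂(Measure.pi fun _ => innovation d) =
      ∫⁻ v : Fin k → USphere d, Measure.pi (fun _ : Fin k => gaussianReal 0 1)
        {z | trajectory (invSqrt S) k x (fun i => (v i, z i)) ∈ A}
        ∂(Measure.pi fun _ => uniformSphere d) := by
    intro x
    have hm2 : Measurable (fun q : (Fin k → USphere d) × (Fin k → ℝ) =>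
        A.indicator (1 : Space d → ℝ≥0∞)
          (trajectory (invSqrt S) k x (fun i => (q.1 i, q.2 i)))) :=
      (measurable_one.indicator hA).comp (measurable_trajectory_right _ _ _)
    have h2 := (measurePreserving_arrowProdEquivProdArrow (USphere d) ℝ (Fin k)
      (fun _ => uniformSphere d) (fun _ => gaussianReal 0 1)).lintegral_comp hm2
    rw [lintegral_prod _ hm2.aemeasurable] at h2
    refine (Eq.trans h2 ?_)
    refine lintegral_congr fun v => ?_
    have hm : MeasurableSet
        {z : Fin k → ℝ | trajectory (invSqrt S) k x (fun i => (v i, z i)) ∈ A} :=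
      ((measurable_trajectory_right (invSqrt S) k x).comp measurable_prodMk_left) hA
    rw [← lintegral_indicator_one hm]
    rfl
  rw [key x, key y]
  set r := ‖y - x‖ with hr
  have hr0 : r ≠ 0 := norm_ne_zero_iff.2 (sub_ne_zero.2 hxy.symm)
  set e : Space d := r⁻¹ • (y - x) with he_def
  have he : ‖e‖ = 1 := norm_smul_inv_norm (𝕜 := ℝ) (sub_ne_zero.2 hxy.symm)
  have hre : y - x = r • e := by rw [he_def, smul_smul, mul_inv_cancel₀ hr0, one_smul]
  have hmc : Measurable (fun v : Fin k → USphere d => controlCost e (fun i => (v i : Space d))) :=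
    (measurable_controlCost e).comp (by fun_prop)
  refine (lintegral_mono fun v => pi_trajectory_le hS (by omega) r hre v hA).trans ?_
  rw [lintegral_add_right _ (by fun_prop), lintegral_const_mul _ (by fun_prop),
    lintegral_add_left measurable_const]
  simp only [lintegral_const, measure_univ, mul_one]
  refine add_le_add le_rfl ?_
  have hc := lintegral_controlCost_uniformSphere_le hk he
  -- Passing from the Euclidean to the weighted distance costs `m^{-1/2}`, which with `√M` produces
  -- `√κ`.
  have h1 : √(minEig S) * r ≤ ‖invSqrt S (x - y)‖ := by
    refine le_of_sq_le_sq ?_ (norm_nonneg _)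
    rw [mul_pow, Real.sq_sqrt hmin.le, hr, ← norm_neg (y - x), neg_sub]
    exact le_norm_invSqrt_sq hS _
  have hrabs : |r| = r := abs_of_nonneg (norm_nonneg _)
  have hsm : 0 < √(minEig S) := Real.sqrt_pos.2 hmin
  have h2 : k * √(maxEig S) * |r| * 2 ≤
      2 * k * √(maxEig S / minEig S) * ‖invSqrt S (x - y)‖ := by
    rw [hrabs, Real.sqrt_div hM.le]
    calc k * √(maxEig S) * r * 2 =
        2 * k * (√(maxEig S) / √(minEig S)) * (√(minEig S) * r) := by field_simp
      _ ≤ _ := by gcongr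
  calc _ ≤ ENNReal.ofReal (k * √(maxEig S) * |r|) * (1 + 1) := by gcongr
    _ = ENNReal.ofReal (k * √(maxEig S) * |r| * 2) := by
      rw [ENNReal.ofReal_mul' zero_le_two, one_add_one_eq_two, ENNReal.ofReal_ofNat]
    _ ≤ _ := by
      rw [← ENNReal.ofReal_mul (by positivity)]
      exact ENNReal.ofReal_le_ofReal h2

theorem lintegral_norm_le_cost_rpow [NeZero d] (S : Matrix (Fin d) (Fin d) ℝ)
    (q : Measure (Space d × Space d)) [IsProbabilityMeasure q] :
    ∫⁻ z, ENNReal.ofReal ‖invSqrt S (z.1 - z.2)‖ ∂q ≤ cost S q ^ (1 / 2 : ℝ) := by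
  have h := ENNReal.lintegral_mul_le_Lp_mul_Lq q (Real.HolderConjugate.two_two)
    (f := fun z : Space d × Space d => ENNReal.ofReal ‖invSqrt S (z.1 - z.2)‖)
    (g := fun _ => 1) (by fun_prop) (by fun_prop)
  simp only [Pi.mul_apply, mul_one, ENNReal.one_rpow, lintegral_const, measure_univ] at h
  refine h.trans_eq ?_
  rw [cost]
  congr 1
  refine lintegral_congr fun z => ?_
  rw [ENNReal.rpow_two, ENNReal.ofReal_pow (norm_nonneg _)]

theorem lawAfter_apply_eq [NeZero d] (hS : S.PosDef) (k : ℕ) (η : Measure (Space d))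
    {A : Set (Space d)} (hA : MeasurableSet A) :
    lawAfter (hitAndRun (gaussianDensity S) (measurable_gaussianDensity S)) η k A =
      ∫⁻ x, ∫⁻ ω, A.indicator 1 (trajectory (invSqrt S) k x ω)
        ∂(Measure.pi fun _ => innovation d) ∂η := by
  rw [← lintegral_lawAfter hS k η (measurable_one.indicator hA), lintegral_indicator_one hA]

theorem measurable_lintegral_trajectory [NeZero d] (S : Matrix (Fin d) (Fin d) ℝ) (k : ℕ)
    {A : Set (Space d)} (hA : MeasurableSet A) :
    Measurable (fun x => ∫⁻ ω, A.indicator (1 : Space d → ℝ≥0∞) (trajectory (invSqrt S) k x ω)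
      ∂(Measure.pi fun _ => innovation d)) :=
  ((measurable_one.indicator hA).comp (measurable_trajectory _ k)).lintegral_prod_right'

theorem lawAfter_le_add_cost [NeZero d] (hS : S.PosDef) {k : ℕ} (hk : k = 3 * d + 2)
    (q : Measure (Space d × Space d)) [IsProbabilityMeasure q]
    {A : Set (Space d)} (hA : MeasurableSet A) :
    lawAfter (hitAndRun (gaussianDensity S) (measurable_gaussianDensity S)) q.fst k A ≤
      lawAfter (hitAndRun (gaussianDensity S) (measurable_gaussianDensity S)) q.snd k A +
        ENNReal.ofReal (2 * k * √(maxEig S / minEig S)) * cost S q ^ (1 / 2 : ℝ) ∧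
    lawAfter (hitAndRun (gaussianDensity S) (measurable_gaussianDensity S)) q.snd k A ≤
      lawAfter (hitAndRun (gaussianDensity S) (measurable_gaussianDensity S)) q.fst k A +
        ENNReal.ofReal (2 * k * √(maxEig S / minEig S)) * cost S q ^ (1 / 2 : ℝ) := by
  have hm := measurable_lintegral_trajectory S k hA
  have hN : Measurable (fun z : Space d × Space d =>
      ENNReal.ofReal ‖invSqrt S (z.1 - z.2)‖) := by fun_prop
  rw [lawAfter_apply_eq hS k _ hA, lawAfter_apply_eq hS k _ hA, Measure.fst, Measure.snd,
    lintegral_map hm measurable_fst, lintegral_map hm measurable_snd]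
  constructor
  · calc _ ≤ _ := lintegral_mono fun z : Space d × Space d =>
          lintegral_trajectory_le hS hk z.1 z.2 hA
      _ = _ := lintegral_add_right _ (hN.const_mul _)
      _ ≤ _ := by
        rw [lintegral_const_mul _ hN]
        gcongr
        exact lintegral_norm_le_cost_rpow S q
  · calc _ ≤ _ := lintegral_mono fun z : Space d × Space d =>
          lintegral_trajectory_le hS hk z.2 z.1 hA
      _ = _ := lintegral_add_right _ (by fun_prop)
      _ ≤ _ := by
        rw [lintegral_const_mul _ (by fun_prop)]
        gcongr
        refine le_trans (le_of_eq ?_) (lintegral_norm_le_cost_rpow S q)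
        refine lintegral_congr fun z => ?_
        rw [← norm_neg, ← map_neg, neg_sub]

end Smoothing

/-! ### Combination of contraction and smoothing. -/

section Mixing

variable {d : ℕ} {S : Matrix (Fin d) (Fin d) ℝ}

/-- The cost contracts by `1 - 2ρ ≤ exp (-2ρ)`; the square root halves the exponent. -/
theorem one_sub_two_mul_rate_pow_rpow_le (S : Matrix (Fin d) (Fin d) ℝ) (n : ℕ) (c : ℝ≥0∞) :
    (ENNReal.ofReal (1 - 2 * rate S) ^ n * c) ^ (1 / 2 : ℝ) ≤
      ENNReal.ofReal (Real.exp (-(rate S * n))) * c ^ (1 / 2 : ℝ) := by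
  have h1 : ENNReal.ofReal (1 - 2 * rate S) ^ n ≤
      ENNReal.ofReal (Real.exp (-(rate S * n))) ^ 2 := by
    calc ENNReal.ofReal (1 - 2 * rate S) ^ n ≤ ENNReal.ofReal (Real.exp (-(2 * rate S))) ^ n := by
          gcongr
          have := Real.add_one_le_exp (-(2 * rate S))
          linarith
      _ = _ := by
          rw [← ENNReal.ofReal_pow (Real.exp_pos _).le, ← ENNReal.ofReal_pow (Real.exp_pos _).le,
            ← Real.exp_nat_mul, ← Real.exp_nat_mul]
          congr 2
          push_cast
          ring
  calc _ ≤ (ENNReal.ofReal (Real.exp (-(rate S * n))) ^ 2 * c) ^ (1 / 2 : ℝ) := by gcongr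
    _ = _ := by
      rw [ENNReal.mul_rpow_of_nonneg _ _ (by norm_num), ← ENNReal.rpow_two, ← ENNReal.rpow_mul]
      norm_num

theorem lawAfter_add {Ω : Type*} [MeasurableSpace Ω] (π : Kernel Ω Ω) (ν : Measure Ω) (k n : ℕ) :
    lawAfter π ν (k + n) = lawAfter π (lawAfter π ν n) k :=
  Function.iterate_add_apply _ k n ν

variable [NeZero d]

/-- Total variation bound after `n` contracting steps followed by `3 d + 2` smoothing steps. -/
theorem lawAfter_le_add_wasserstein (hS : S.PosDef) (ν : Measure (Space d)) (n : ℕ)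
    {A : Set (Space d)} (hA : MeasurableSet A) :
    multivariateGaussian 0 S A ≤
      lawAfter (hitAndRun (gaussianDensity S) (measurable_gaussianDensity S)) ν (3 * d + 2 + n) A +
        ENNReal.ofReal (2 * (3 * d + 2 : ℕ) * √(maxEig S / minEig S) *
          Real.exp (-(rate S * n))) * wasserstein S (multivariateGaussian 0 S) ν ∧
    lawAfter (hitAndRun (gaussianDensity S) (measurable_gaussianDensity S)) ν (3 * d + 2 + n) A ≤
      multivariateGaussian 0 S A +
        ENNReal.ofReal (2 * (3 * d + 2 : ℕ) * √(maxEig S / minEig S) *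
          Real.exp (-(rate S * n))) * wasserstein S (multivariateGaussian 0 S) ν := by
  set π := hitAndRun (gaussianDensity S) (measurable_gaussianDensity S) with hπ
  set γ := multivariateGaussian 0 S with hγ
  set D := ENNReal.ofReal (2 * (3 * d + 2 : ℕ) * √(maxEig S / minEig S) *
          Real.exp (-(rate S * n))) with hD
  have hM := maxEig_pos hS
  have hm := minEig_pos hS
  have hD0 : D ≠ 0 := by
    rw [hD]
    refine (ENNReal.ofReal_pos.2 ?_).ne'
    have := Real.exp_pos (-(rate S * n))
    positivity
  have hDtop : D ≠ ∞ := ENNReal.ofReal_ne_top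
  have key : ∀ q : Measure (Space d × Space d), q.fst = γ → q.snd = ν →
      γ A ≤ lawAfter π ν (3 * d + 2 + n) A + D * cost S q ^ (1 / 2 : ℝ) ∧
      lawAfter π ν (3 * d + 2 + n) A ≤ γ A + D * cost S q ^ (1 / 2 : ℝ) := by
    intro q h1 h2
    have hq : IsProbabilityMeasure q :=
      ⟨by rw [← Measure.fst_univ, h1]; exact measure_univ⟩
    obtain ⟨q', hq', g1, g2, g3⟩ := exists_coupling_lawAfter hS n q
    have hs := lawAfter_le_add_cost hS rfl q' hA
    rw [g1, g2, h1, h2, ← lawAfter_add, ← lawAfter_add, lawAfter_multivariateGaussian hS] at hs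
    have hc : ENNReal.ofReal (2 * (3 * d + 2 : ℕ) * √(maxEig S / minEig S)) *
        cost S q' ^ (1 / 2 : ℝ) ≤ D * cost S q ^ (1 / 2 : ℝ) := by
      rw [hD, ENNReal.ofReal_mul (q := Real.exp (-(rate S * n))) (by positivity),
        mul_assoc (ENNReal.ofReal _)]
      exact mul_le_mul_right ((ENNReal.rpow_le_rpow g3 (by norm_num)).trans
        (one_sub_two_mul_rate_pow_rpow_le S n _)) _
    exact ⟨hs.1.trans (add_le_add le_rfl hc), hs.2.trans (add_le_add le_rfl hc)⟩
  have hinf : ∀ a b : ℝ≥0∞, (∀ q : Measure (Space d × Space d), q.fst = γ → q.snd = ν →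
      a ≤ b + D * cost S q ^ (1 / 2 : ℝ)) → a ≤ b + D * wasserstein S γ ν := by
    intro a b h
    rw [← tsub_le_iff_left]
    -- The estimate is squared first because `wasserstein` takes the root outside the infimum.
    have h1 : ((a - b) / D) ^ 2 ≤ ⨅ (q : Measure (Space d × Space d)) (_ : q.fst = γ)
        (_ : q.snd = ν), ∫⁻ z, ENNReal.ofReal (‖invSqrt S (z.1 - z.2)‖ ^ 2) ∂q := by
      refine le_iInf fun q => le_iInf fun h1 => le_iInf fun h2 => ?_
      have h3 := tsub_le_iff_left.2 (h q h1 h2)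
      have h4 : (a - b) / D ≤ cost S q ^ (1 / 2 : ℝ) :=
        ENNReal.div_le_of_le_mul (by rwa [mul_comm])
      calc ((a - b) / D) ^ 2 ≤ (cost S q ^ (1 / 2 : ℝ)) ^ 2 := by gcongr
        _ = cost S q := by
          rw [← ENNReal.rpow_two, ← ENNReal.rpow_mul]
          norm_num
    have h2 : (a - b) / D ≤ wasserstein S γ ν := by
      have h3 := ENNReal.rpow_le_rpow h1 (z := (1 / 2 : ℝ)) (by norm_num)
      rw [← ENNReal.rpow_two, ← ENNReal.rpow_mul] at h3
      norm_num at h3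
      rw [wasserstein]
      norm_num
      exact h3
    rw [mul_comm]
    exact (ENNReal.div_le_iff hD0 hDtop).1 h2
  exact ⟨hinf _ _ fun q h1 h2 => (key q h1 h2).1, hinf _ _ fun q h1 h2 => (key q h1 h2).2⟩

theorem isProbabilityMeasure_lawAfter (hS : S.PosDef) (ν : Measure (Space d))
    [IsProbabilityMeasure ν] (n : ℕ) : IsProbabilityMeasure
      (lawAfter (hitAndRun (gaussianDensity S) (measurable_gaussianDensity S)) ν n) := by
  refine ⟨?_⟩
  rw [lawAfter_apply_eq hS n ν MeasurableSet.univ]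
  simp

theorem tvDist_lawAfter_le (hS : S.PosDef) (ν : Measure (Space d)) [IsProbabilityMeasure ν]
    (n : ℕ) (hW : wasserstein S (multivariateGaussian 0 S) ν ≠ ∞) :
    tvDist (lawAfter (hitAndRun (gaussianDensity S) (measurable_gaussianDensity S)) ν
      (3 * d + 2 + n)) (multivariateGaussian 0 S) ≤
      2 * (3 * d + 2 : ℕ) * √(maxEig S / minEig S) * Real.exp (-(rate S * n)) *
        (wasserstein S (multivariateGaussian 0 S) ν).toReal := by
  have : Nonempty {A : Set (Space d) // MeasurableSet A} := ⟨⟨∅, MeasurableSet.empty⟩⟩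
  have hp := isProbabilityMeasure_lawAfter hS ν (3 * d + 2 + n)
  refine ciSup_le fun A => ?_
  obtain ⟨h1, h2⟩ := lawAfter_le_add_wasserstein hS ν n A.2
  have hD : (0 : ℝ) ≤ 2 * (3 * d + 2 : ℕ) * √(maxEig S / minEig S) *
      Real.exp (-(rate S * n)) := by
    have := Real.exp_pos (-(rate S * n))
    positivity
  have hfin : ENNReal.ofReal (2 * (3 * d + 2 : ℕ) * √(maxEig S / minEig S) *
      Real.exp (-(rate S * n))) * wasserstein S (multivariateGaussian 0 S) ν ≠ ∞ :=
    ENNReal.mul_ne_top ENNReal.ofReal_ne_top hW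
  have h3 := ENNReal.toReal_mono (ENNReal.add_ne_top.2 ⟨measure_ne_top _ _, hfin⟩) h1
  have h4 := ENNReal.toReal_mono (ENNReal.add_ne_top.2 ⟨measure_ne_top _ _, hfin⟩) h2
  rw [ENNReal.toReal_add (measure_ne_top _ _) hfin, ENNReal.toReal_mul,
    ENNReal.toReal_ofReal hD] at h3 h4
  rw [abs_le, Measure.real, Measure.real]
  constructor <;> linarith

theorem mixingTime_le_of_tvDist_le {Ω : Type*} [MeasurableSpace Ω] {π : Kernel Ω Ω}
    {μ ν : Measure Ω} {ε : ℝ} {n : ℕ} (h : tvDist (lawAfter π ν n) μ ≤ ε) :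
    mixingTime π μ ν ε ≤ n :=
  iInf₂_le n h

theorem one_le_condNumber (hS : S.PosDef) : 1 ≤ maxEig S / minEig S :=
  (one_le_div (minEig_pos hS)).2 (minEig_le_maxEig hS)

/-- The mixing time bound for finite Wasserstein distance, in real form. -/
theorem exists_tvDist_le (hS : S.PosDef) (ν : Measure (Space d)) [IsProbabilityMeasure ν]
    {ε : ℝ} (hε : 0 < ε) (hW : wasserstein S (multivariateGaussian 0 S) ν ≠ ∞) {K : ℝ}
    (hK : condNumber S ≤ K) :
    ∃ N : ℕ, tvDist (lawAfter (hitAndRun (gaussianDensity S) (measurable_gaussianDensity S)) ν N)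
        (multivariateGaussian 0 S) ≤ ε ∧
      (N : ℝ) ≤ 4 * (rate S)⁻¹ * Real.log (max (Real.exp 1)
        (10 * K * d * ε⁻¹ * (wasserstein S (multivariateGaussian 0 S) ν).toReal)) := by
  set w := (wasserstein S (multivariateGaussian 0 S) ν).toReal with hw
  have hw0 : 0 ≤ w := ENNReal.toReal_nonneg
  set X := max (Real.exp 1) (10 * K * d * ε⁻¹ * w) with hX
  have hXpos : 0 < X := (Real.exp_pos 1).trans_le (le_max_left _ _)
  have hlog : 1 ≤ Real.log X := by
    rw [Real.le_log_iff_exp_le hXpos]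
    exact le_max_left _ _
  have hρ := rate_pos hS
  have hρd := rate_mul_dim_le hS
  have hd : (1 : ℝ) ≤ d := by exact_mod_cast Nat.pos_of_neZero d
  have hinv : 2 * (d : ℝ) ≤ (rate S)⁻¹ := by
    rw [le_inv_comm₀ (by positivity) hρ, ← one_div, le_div_iff₀ (by positivity)]
    exact hρd
  set n := ⌈(rate S)⁻¹ * Real.log X⌉₊ with hn
  have hn1 : (rate S)⁻¹ * Real.log X ≤ n := Nat.le_ceil _
  -- The choice of `n` gives `exp (-ρ n) ≤ 1 / X`; this upper bound serves the step count.
  have hn2 : (n : ℝ) < (rate S)⁻¹ * Real.log X + 1 := Nat.ceil_lt_add_one (by positivity)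
  refine ⟨3 * d + 2 + n, (tvDist_lawAfter_le hS ν n hW).trans ?_, ?_⟩
  · have hexp : Real.exp (-(rate S * n)) ≤ X⁻¹ := by
      rw [Real.exp_neg]
      refine inv_anti₀ hXpos ((Real.log_le_iff_le_exp hXpos).1 ?_)
      calc Real.log X = rate S * ((rate S)⁻¹ * Real.log X) := by field_simp
        _ ≤ _ := by gcongr
    have hκ := one_le_condNumber hS
    have hsqrt : √(maxEig S / minEig S) ≤ K := by
      refine le_trans ?_ hK
      rw [Real.sqrt_le_left (by rw [condNumber]; linarith), condNumber]
      nlinarith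
    have hK0 : 0 ≤ K := (Real.sqrt_nonneg _).trans hsqrt
    -- Source of the constant `C' = 10`, using `d ≥ 1`.
    have hdk : (2 * (3 * d + 2 : ℕ) : ℝ) ≤ 10 * d := by
      push_cast
      linarith
    have hXle : 10 * K * d * w ≤ ε * X := by
      calc 10 * K * d * w = ε * (10 * K * d * ε⁻¹ * w) := by field_simp
        _ ≤ ε * X := by
          gcongr
          exact le_max_right _ _
    rw [← hw]
    calc _ ≤ 10 * d * K * X⁻¹ * w := by gcongr
      _ = (10 * K * d * w) * X⁻¹ := by ring
      _ ≤ ε * X * X⁻¹ := by gcongr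
      _ = ε := by field_simp
  · push_cast
    -- Smoothing and rounding use at most `3 d + 3 ≤ 6 d ≤ 3 ρ⁻¹` steps; with the contraction steps
    -- this gives `C = 4`.
    have h1 : (rate S)⁻¹ ≤ (rate S)⁻¹ * Real.log X := le_mul_of_one_le_right (by positivity) hlog
    nlinarith

end Mixing

end HitAndRun

end

theorem theorem3 :
    ∃ C C' : ℝ, 0 < C ∧ 0 < C' ∧
      ∀ (d : ℕ), 0 < d →
      ∀ (S : Matrix (Fin d) (Fin d) ℝ), S.PosDef →
      ∀ (ν : Measure (EuclideanSpace ℝ (Fin d))), IsProbabilityMeasure ν →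
      ∀ (ε : ℝ), 0 < ε →
        (((HitAndRun.mixingTime
            (HitAndRun.hitAndRun (HitAndRun.gaussianDensity S)
              (HitAndRun.measurable_gaussianDensity S))
            (multivariateGaussian 0 S) ν ε : ℕ∞) : ℝ≥0∞) : EReal) ≤
          ((C * (HitAndRun.rate S)⁻¹ : ℝ) : EReal) *
            ENNReal.log (max (ENNReal.ofReal (Real.exp 1))
              (ENNReal.ofReal (C' *
                  max (HitAndRun.condNumber S)
                    (max (HitAndRun.maxEig S) (HitAndRun.minEig S)⁻¹) * (d : ℝ) * ε⁻¹) *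
                HitAndRun.wasserstein S (multivariateGaussian 0 S) ν)) := by
  refine ⟨4, 10, by norm_num, by norm_num, fun d hd S hS ν hν ε hε => ?_⟩
  have : NeZero d := ⟨hd.ne'⟩
  have hd' : (0 : ℝ) < d := by exact_mod_cast hd
  have hρ := HitAndRun.rate_pos hS
  set K := max (HitAndRun.condNumber S) (max (HitAndRun.maxEig S) (HitAndRun.minEig S)⁻¹) with hK
  have hK0 : 0 < K :=
    (HitAndRun.maxEig_pos hS).trans_le ((le_max_left _ _).trans (le_max_right _ _))
  have hc : 0 < 10 * K * d * ε⁻¹ := by positivity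
  rcases eq_or_ne (HitAndRun.wasserstein S (multivariateGaussian 0 S) ν) ∞ with hW | hW
  · rw [hW, ENNReal.mul_top (ENNReal.ofReal_pos.2 hc).ne', max_eq_right le_top, ENNReal.log_top,
      EReal.coe_mul_top_of_pos (by positivity)]
    exact le_top
  -- The argument needs only `κ ≤ K`; the other two terms of the maximum merely enlarge the bound.
  obtain ⟨N, hN, hle⟩ := HitAndRun.exists_tvDist_le hS ν hε hW (le_max_left _ _ : _ ≤ K)
  set w := HitAndRun.wasserstein S (multivariateGaussian 0 S) ν with hw
  have hX : max (ENNReal.ofReal (Real.exp 1)) (ENNReal.ofReal (10 * K * d * ε⁻¹) * w) =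
      ENNReal.ofReal (max (Real.exp 1) (10 * K * d * ε⁻¹ * w.toReal)) := by
    rw [ENNReal.ofReal_max, ENNReal.ofReal_mul hc.le, ENNReal.ofReal_toReal hW]
  rw [hX, ENNReal.log_ofReal_of_pos ((Real.exp_pos 1).trans_le (le_max_left _ _)), ← EReal.coe_mul]
  calc _ ≤ (((N : ℕ∞) : ℝ≥0∞) : EReal) := by
        rw [EReal.coe_ennreal_le_coe_ennreal_iff, ENat.toENNReal_le]
        exact HitAndRun.mixingTime_le_of_tvDist_le hN
    _ = ((N : ℝ) : EReal) := by
        rw [ENat.toENNReal_coe, ← ENNReal.ofReal_natCast, EReal.coe_ennreal_ofReal,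
          max_eq_left (Nat.cast_nonneg _)]
    _ ≤ _ := EReal.coe_le_coe_iff.2 hle
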